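/- **Quantum Giambelli formula for the Gaudin model.** Let $N,n\ge 0$ be integers, $h\in \mathrm{Mat}_N(\mathbb C)$ (the twist matrix), $x_1,\dots,x_n\in\mathbb C$ (the marked points) and $x\in\mathbb C$. For a Young diagram $\lambda$ with $\ell(\lambda)$ rows let $$\chi_\lambda(h)=s_\lambda(\mathbf y)=\det_{1\le i,j\le \ell(\lambda)} h_{\lambda_i-i+j}(\mathbf y),\qquad y_k=\tfrac1k\,\mathrm{tr}\,h^k,$$ where $\exp\bigl(\sum_{k\ge1}y_kz^k\bigr)=\sum_{k\ge0}h_k(\mathbf y)z^k$ and $h_k=0$ for $k<0$. For a function $F$ on $\mathrm{Mat}_N(\mathbb C)$ with values in $\mathrm{End}\bigl((\mathbb C^N)^{\otimes n}\bigr)$ let $$({\sf d}_iF)(h)=\frac{\partial}{\partial\varepsilon}\sum_{a,b=1}^N e^{(i)}_{ab}\,F(h+\varepsilon e_{ba})\Big|_{\varepsilon=0},$$ where $e_{ab}$ are the matrix units and $e^{(i)}_{ab}$ is $e_{ab}$ acting in the $i$-th tensor factor. The Gaudin transfer matrices are the operators on $(\mathbb C^N)^{\otimes n}$ $${\sf T}^G_\lambda(x)=\Bigl(1+\frac{{\sf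 d}_n}{x-x_n}\Bigr)\cdots\Bigl(1+\frac{{\sf d}_1}{x-x_1}\Bigr)\chi_\lambda(h)\quad(x\ne x_1,\dots,x_n),\qquad T^G_\lambda(x)=(x-x_n+{\sf d}_n)\cdots(x-x_1+{\sf d}_1)\chi_\lambda(h).$$ Write ${\sf T}^G_{l,k}={\sf T}^G_{(l+1,1^k)}$ and $T^G_{l,k}=T^G_{(l+1,1^k)}$ for $l,k\ge0$, let $\lambda'$ be the transposed diagram, and let $d(\lambda)$ be the number of boxes on the main diagonal of $\lambda$. Then: 1. If $x\ne x_1,\dots,x_n$, the operators ${\sf T}^G_{l,k}(x)$, $l,k\ge 0$, commute pairwise (so that determinants in them are well defined), and for every Young diagram $\lambda$ $${\sf T}^G_\lambda(x)=\det_{1\le i,j\le d(\lambda)}{\sf T}^G_{\lambda_i-i,\,\lambda'_j-j}(x).$$ 2. For every $x$, the operators $T^G_{l,k}(x)$, $l,k\ge0$, commute pairwise, and for every non-empty Young diagram $\lambda$ $$T^G_\lambda(x)\,\bigl(T^G_\emptyset(x)\bigr)^{d(\lambda)-1}=\det_{1\le i,j\le d(\lambda)}T^G_{\lambda_i-i,\,\lambda'_j-j}(x).$$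 -/

import Mathlib

open scoped PowerSeries

noncomputable section

namespace Gaudin

/-- The power sums `y_k = (1/k) tr h^k`, `k ≥ 1`, attached to a square matrix `h`. -/
def times {N : ℕ} (h : Matrix (Fin N) (Fin N) ℂ) (k : ℕ) : ℂ :=
  (h ^ k).trace / (k : ℂ)

/-- The formal series `ξ(y, z) = ∑_{k ≥ 1} y_k z^k` (no constant term). -/
def xi (y : ℕ → ℂ) : ℂ⟦X⟧ :=
  PowerSeries.mk fun k => if k = 0 then 0 else y k

/-- The complete symmetric polynomials: `exp (ξ(y, z)) = ∑_{k ≥ 0} h_k(y) z^k`,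
with `h_k = 0` for `k < 0`. -/
def completeSym (y : ℕ → ℂ) (k : ℤ) : ℂ :=
  if 0 ≤ k then PowerSeries.coeff k.toNat ((PowerSeries.exp ℂ).subst (xi y)) else 0

/-- The Schur polynomial `s_μ(y) = det_{i,j = 1..ℓ(μ)} h_{μ_i - i + j}(y)`. -/
def schur (μ : YoungDiagram) (y : ℕ → ℂ) : ℂ :=
  (Matrix.of fun i j : Fin (μ.colLen 0) =>
    completeSym y ((μ.rowLen i : ℤ) - (i : ℤ) + (j : ℤ))).det

/-- The character `χ_μ(h) = s_μ(y)`, `y_k = (1/k) tr h^k`, as a polynomial function on all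
`N × N` matrices. -/
def chi {N : ℕ} (μ : YoungDiagram) (h : Matrix (Fin N) (Fin N) ℂ) : ℂ :=
  schur μ (times h)

/-- Operators on `(ℂ^N)^{⊗ n}`, written as matrices in the standard basis
`e_{u 0} ⊗ ⋯ ⊗ e_{u (n-1)}`, which is indexed by `u : Fin n → Fin N`. -/
abbrev Op (N n : ℕ) : Type := Matrix (Fin n → Fin N) (Fin n → Fin N) ℂ

/-- The operator `e_{ab}^{(i)} = 1 ⊗ ⋯ ⊗ e_{ab} ⊗ ⋯ ⊗ 1`, with the matrix unit `e_{ab}`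
at site `i`. -/
def siteUnit {N n : ℕ} (i : Fin n) (a b : Fin N) : Op N n :=
  Matrix.of fun u v => if u i = a ∧ v i = b ∧ ∀ j, j ≠ i → u j = v j then 1 else 0

/-- The directional derivative `∂/∂ε F(h + ε k)` at `ε = 0` of an operator-valued function. -/
def dirDeriv {N n : ℕ} (F : Matrix (Fin N) (Fin N) ℂ → Op N n)
    (k h : Matrix (Fin N) (Fin N) ℂ) : Op N n :=
  Matrix.of fun u v => deriv (fun ε : ℂ => F (h + ε • k) u v) 0

/-- The matrix derivative at site `i`:
`(d_i F)(h) = ∂/∂ε ∑_{a,b} e_{ab}^{(i)} F(h + ε e_{ba})` at `ε = 0`. -/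
def matDeriv {N n : ℕ} (i : Fin n) (F : Matrix (Fin N) (Fin N) ℂ → Op N n) :
    Matrix (Fin N) (Fin N) ℂ → Op N n :=
  fun h => ∑ a : Fin N, ∑ b : Fin N, siteUnit i a b * dirDeriv F (Matrix.single b a 1) h

/-- The Gaudin transfer matrix in the normalization with `T_∅ = 1`, as a function of the
twist matrix:
`(1 + d_n / (x - x_n)) ⋯ (1 + d_1 / (x - x_1)) χ_μ(h)`, where `d_1` is applied first. -/
def transferN {N n : ℕ} (p : Fin n → ℂ) (x : ℂ) (μ : YoungDiagram) :
    Matrix (Fin N) (Fin N) ℂ → Op N n :=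
  (List.finRange n).foldl
    (fun F i => fun h => F h + (x - p i)⁻¹ • matDeriv i F h)
    (fun h => chi μ h • (1 : Op N n))

/-- The Gaudin transfer matrix in the polynomial normalization, as a function of the
twist matrix:
`(x - x_n + d_n) ⋯ (x - x_1 + d_1) χ_μ(h)`, where `d_1` is applied first. -/
def transferPoly {N n : ℕ} (p : Fin n → ℂ) (x : ℂ) (μ : YoungDiagram) :
    Matrix (Fin N) (Fin N) ℂ → Op N n :=
  (List.finRange n).foldl
    (fun F i => fun h => (x - p i) • F h + matDeriv i F h)
    (fun h => chi μ h • (1 : Op N n))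

/-- The hook diagram `(l + 1, 1^k)`. -/
def hook (l k : ℕ) : YoungDiagram :=
  YoungDiagram.ofRowLens ((l + 1) :: List.replicate k 1) (by
    rw [List.sortedGE_iff_pairwise, List.pairwise_cons]
    refine ⟨fun a ha => ?_, List.pairwise_replicate_of_refl⟩
    rw [List.eq_of_mem_replicate ha]
    omega)

/-- The number `d(μ)` of boxes on the main diagonal of `μ`. -/
def diagLen (μ : YoungDiagram) : ℕ :=
  (μ.cells.filter fun c => c.1 = c.2).card

/-- The determinant `∑_σ sign(σ) A_{σ 1, 1} ⋯ A_{σ d, d}` of a square matrix with entries in a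
ring, the factors being multiplied from left to right in the order of the columns. When the
entries commute pairwise it does not depend on the order of the factors, and is the usual
determinant. -/
def opDet {R : Type*} [Ring R] {d : ℕ} (A : Matrix (Fin d) (Fin d) R) : R :=
  ∑ σ : Equiv.Perm (Fin d), (Equiv.Perm.sign σ : ℤ) • (List.ofFn fun j => A (σ j) j).prod

/-- The diagram `(α | β)` at position `(i, j)` of the Giambelli determinant of `μ`: the hook
with `α = μ_i - i`, `β = μ'_j - j` for `i, j = 1, …, d(μ)`. Here rows and columns are counted
from `0`; for `i, j < d(μ)` the subtractions do not truncate. -/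
def frobeniusHook (μ : YoungDiagram) (i j : Fin (diagLen μ)) : YoungDiagram :=
  hook (μ.rowLen i - (i + 1)) (μ.colLen j - (j + 1))

end Gaudin

end

/-! The classical Giambelli formula holds for the scalar characters, and the product of the factors
`1 + a_i d_i` is applied to it one site at a time. The point is that each factor carries the
determinant of hook operators to the determinant of the transformed hook operators.

Write `s_(l|k)` for the hook character, `h_m` and `e_k` for the complete and elementary ones, `H`
for the twist matrix, and `∂` for the gradient in `H`. From `∂h_{m+1} = h_m + H ∂h_m`, `∂e_{k+1} =
e_k - H ∂e_k` and `s_(l|k+1) + s_(l+1|k) = h_{l+1} e_{k+1}` one gets the rank-one identity `∂s_(l|k)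
= ∂h_{l+1} ∂e_{k+1}` (`grad_hookPoly`). It survives the factors of the other sites. Indeed, iterated
derivatives of `h_m` over a set of sites are symmetric under exchanges of these sites and those of
`e_k` are antisymmetric, so their products over at least two common sites vanish and all correction
terms drop out (`gaudinOp_polyDeriv_hookPoly`). The closed form of the iterated derivatives, a
(anti)symmetrizer times commuting resolvents of `H` at the sites, also gives the commutativity of
the hook operators (`iterDeriv_smul_one`, `gaudinOp_hookPoly_commute`).

Now let `Φ_{lk}` be the hook operators for the sites treated so far, let `i` be a new site and `E =
d_i Φ`. The matrix `E` has the form `E_{lk} = E_{l0} E_{0k}` with `E_{00} = 1`, so `det(Φ + tE)` is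
affine in `t` (`natDegree_opDet_le_one`). Its linear coefficient is `d_i det Φ`, because `d_i` obeys
the Leibniz rule on operators trivial at `i`. Hence `det(Φ + a_i d_i Φ) = (1 + a_i d_i) det Φ`,
which is the induction step (`gaudinOp_det_hookPoly`).

The derivatives are computed formally over the polynomial ring in the entries of `H` and then
evaluated. The polynomial normalization follows by rescaling when `x` is not a marked point, and at
the marked points by continuity in `x`. -/

open scoped PowerSeries

noncomputable section

namespace Gaudin

/-! ### Elementary, hook and complete functions as recursive sequences -/

section SymmetricSequences

variable {A B : Type*} [CommRing A] [CommRing B]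

/-- The sequence `e_k` determined by `e_0 = 1` and `∑_j (-1)^j c_j e_{k-j} = 0` for `k ≥ 1`,
where `c_0 = 1`. -/
def elemSeq (c : ℕ → A) : ℕ → A
  | 0 => 1
  | k + 1 => ∑ j : Fin (k + 1), (-1) ^ (j : ℕ) * c (j + 1) * elemSeq c (k - j)

/-- The hook Schur function `s_{(l+1, 1^k)} = ∑_j (-1)^j h_{l+1+j} e_{k-j}`. -/
def hookSeq (c : ℕ → A) (l k : ℕ) : A :=
  ∑ j ∈ Finset.range (k + 1), (-1) ^ j * c (l + 1 + j) * elemSeq c (k - j)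

/-- Complete symmetric functions from power sums, by Newton's identities. -/
def newtonSeq [Algebra ℂ A] (p : ℕ → A) : ℕ → A
  | 0 => 1
  | m + 1 => ((m : ℂ) + 1)⁻¹ • ∑ j : Fin (m + 1), p (j + 1) * newtonSeq p (m - j)

theorem elemSeq_zero (c : ℕ → A) : elemSeq c 0 = 1 := by
  rw [elemSeq]

theorem elemSeq_succ (c : ℕ → A) (k : ℕ) :
    elemSeq c (k + 1) =
      ∑ j ∈ Finset.range (k + 1), (-1) ^ j * c (j + 1) * elemSeq c (k - j) := by
  rw [elemSeq, ← Fin.sum_univ_eq_sum_range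
    (fun j => (-1) ^ j * c (j + 1) * elemSeq c (k - j)) (k + 1)]

theorem hookSeq_zero_left (c : ℕ → A) (k : ℕ) : hookSeq c 0 k = elemSeq c (k + 1) := by
  rw [hookSeq, elemSeq_succ]
  exact Finset.sum_congr rfl fun j _ => by rw [zero_add, add_comm 1 j]

theorem hookSeq_zero_right (c : ℕ → A) (l : ℕ) : hookSeq c l 0 = c (l + 1) := by
  simp [hookSeq, elemSeq_zero]

/-- The two alternating sums telescope: after a shift of the index they differ by sign, and only the
term `j = 0` of the first remains. This Pieri relation drives every induction on the leg length. -/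
theorem hookSeq_add (c : ℕ → A) (l k : ℕ) :
    hookSeq c l (k + 1) + hookSeq c (l + 1) k = c (l + 1) * elemSeq c (k + 1) := by
  rw [hookSeq, hookSeq, Finset.sum_range_succ', add_right_comm, ← Finset.sum_add_distrib,
    Finset.sum_eq_zero]
  · simp
  · intro j _
    rw [Nat.add_sub_add_right, pow_succ, show l + 1 + (j + 1) = l + 1 + 1 + j by ring]
    ring

theorem map_elemSeq (f : A →+* B) (c : ℕ → A) (k : ℕ) :
    f (elemSeq c k) = elemSeq (fun m => f (c m)) k := by
  induction k using Nat.strong_induction_on with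
  | _ k ih =>
    cases k with
    | zero => simp [elemSeq_zero]
    | succ k =>
      rw [elemSeq_succ, elemSeq_succ, map_sum]
      refine Finset.sum_congr rfl fun j _ => ?_
      rw [map_mul, map_mul, map_pow, map_neg, map_one, ih _ (by omega)]

theorem map_hookSeq (f : A →+* B) (c : ℕ → A) (l k : ℕ) :
    f (hookSeq c l k) = hookSeq (fun m => f (c m)) l k := by
  rw [hookSeq, hookSeq, map_sum]
  refine Finset.sum_congr rfl fun j _ => ?_
  rw [map_mul, map_mul, map_pow, map_neg, map_one, map_elemSeq]

variable [Algebra ℂ A] [Algebra ℂ B]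

theorem newtonSeq_zero (p : ℕ → A) : newtonSeq p 0 = 1 := by
  rw [newtonSeq]

theorem newtonSeq_succ (p : ℕ → A) (m : ℕ) :
    ((m : ℂ) + 1) • newtonSeq p (m + 1) =
      ∑ j ∈ Finset.range (m + 1), p (j + 1) * newtonSeq p (m - j) := by
  rw [newtonSeq, ← Fin.sum_univ_eq_sum_range (fun j => p (j + 1) * newtonSeq p (m - j)) (m + 1),
    smul_smul, mul_inv_cancel₀ (by exact_mod_cast Nat.succ_ne_zero m), one_smul]

theorem newtonSeq_unique (p c : ℕ → A) (h0 : c 0 = 1)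
    (h : ∀ m : ℕ, ((m : ℂ) + 1) • c (m + 1) =
      ∑ j ∈ Finset.range (m + 1), p (j + 1) * c (m - j)) (m : ℕ) : c m = newtonSeq p m := by
  induction m using Nat.strong_induction_on with
  | _ m ih =>
    cases m with
    | zero => rw [h0, newtonSeq_zero]
    | succ m =>
      have hm : ((m : ℂ) + 1) ≠ 0 := by exact_mod_cast Nat.succ_ne_zero m
      refine smul_right_injective A hm ?_
      simp only [h, newtonSeq_succ]
      exact Finset.sum_congr rfl fun j _ => by rw [ih _ (by omega)]

theorem map_newtonSeq (f : A →ₐ[ℂ] B) (p : ℕ → A) (m : ℕ) :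
    f (newtonSeq p m) = newtonSeq (fun k => f (p k)) m := by
  refine newtonSeq_unique (fun k => f (p k)) (fun m => f (newtonSeq p m)) ?_ ?_ m
  · rw [newtonSeq_zero, map_one]
  · intro m
    rw [← map_smul, newtonSeq_succ, map_sum]
    exact Finset.sum_congr rfl fun j _ => map_mul _ _ _

end SymmetricSequences

theorem hasSubst_xi (y : ℕ → ℂ) : PowerSeries.HasSubst (xi y) :=
  PowerSeries.HasSubst.of_constantCoeff_zero' (by simp [xi])

/-- Newton's identities are the coefficients of `(exp ξ)' = (exp ξ) ξ'`. The recursive form makes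
sense in any commutative `ℂ`-algebra, in particular for polynomials in the entries of the twist. -/
theorem completeSym_natCast (y : ℕ → ℂ) (m : ℕ) :
    completeSym y m = newtonSeq (fun k => (k : ℂ) * y k) m := by
  have key : ∀ m : ℕ, completeSym y m =
      PowerSeries.coeff m ((PowerSeries.exp ℂ).subst (xi y)) := by
    intro m
    simp [completeSym]
  refine newtonSeq_unique _ (fun m : ℕ => completeSym y m) ?_ ?_ m
  · rw [key, PowerSeries.coeff_zero_eq_constantCoeff_apply]
    refine (PowerSeries.constantCoeff_subst (hasSubst_xi y) _).trans ?_
    have hxi : MvPowerSeries.constantCoeff (xi y) = 0 :=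
      show PowerSeries.constantCoeff (xi y) = 0 by simp [xi]
    rw [finsum_eq_single _ 0 fun d hd => by rw [map_pow, hxi, zero_pow hd, smul_zero]]
    simp
  · intro m
    have h := congrArg (PowerSeries.coeff m)
      (PowerSeries.derivative_subst (f := PowerSeries.exp ℂ) (hasSubst_xi y))
    rw [PowerSeries.derivative_exp, PowerSeries.coeff_derivative, mul_comm _ (PowerSeries.derivative ℂ (xi y)),
      PowerSeries.coeff_mul, Finset.Nat.sum_antidiagonal_eq_sum_range_succ_mk] at h
    simp only [key]
    rw [smul_eq_mul, mul_comm, h]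
    refine Finset.sum_congr rfl fun j _ => ?_
    rw [PowerSeries.coeff_derivative]
    simp only [xi, PowerSeries.coeff_mk, Nat.succ_ne_zero, if_false]
    push_cast
    ring

/-! ### From Jacobi–Trudi to Giambelli for scalar sequences -/

section ScalarGiambelli

/-- The inversions are counted by their left position `i`. For `i < r` every smaller value stands to
the right of `i`, since the earlier values are larger, so there are `π i` of them; for `i ≥ r` there
are none. -/
theorem sign_of_antitone_then_monotone {n : ℕ} (π : Equiv.Perm (Fin n)) (r : ℕ)
    (h₁ : ∀ i j : Fin n, i < j → (j : ℕ) < r → π j < π i)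
    (h₂ : ∀ i j : Fin n, i < j → r ≤ (i : ℕ) → π i < π j) :
    Equiv.Perm.sign π = ∏ i : Fin n, if (i : ℕ) < r then (-1) ^ (π i : ℕ) else 1 := by
  rw [Equiv.Perm.sign_eq_prod_prod_Ioi]
  refine Finset.prod_congr rfl fun i _ => ?_
  split_ifs with hi
  · rw [Finset.prod_ite, Finset.prod_const_one, one_mul, Finset.prod_const]
    congr 1
    have : (Finset.Ioi i).filter (fun j => ¬ π i < π j) =
        (Finset.Iio (π i)).map π.symm.toEmbedding := by
      ext j
      simp only [Finset.mem_filter, Finset.mem_Ioi, Finset.mem_map_equiv, Equiv.symm_symm,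
        Finset.mem_Iio, not_lt]
      constructor
      · rintro ⟨hij, hle⟩
        exact lt_of_le_of_ne hle fun h => hij.ne' (π.injective h)
      · intro hlt
        refine ⟨?_, hlt.le⟩
        by_contra hij
        rcases (not_lt.mp hij).lt_or_eq with h | h
        · exact lt_asymm hlt (h₁ j i h hi)
        · exact hlt.ne (by rw [h])
    rw [this, Finset.card_map, Fin.card_Iio]
  · exact Finset.prod_eq_one fun j hj => if_pos (h₂ i j (Finset.mem_Ioi.mp hj) (not_lt.mp hi))

variable {A : Type*} [CommRing A]

/-- Permuting the columns by `π` makes the matrix block triangular with an identity block. The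
column signs `(-1)^{π j}` of the remaining block multiply to the sign of `π` and cancel it. -/
theorem det_of_unit_rows {n : ℕ} (π : Equiv.Perm (Fin n)) (r : ℕ)
    (h₁ : ∀ i j : Fin n, i < j → (j : ℕ) < r → π j < π i)
    (h₂ : ∀ i j : Fin n, i < j → r ≤ (i : ℕ) → π i < π j)
    (M : Matrix (Fin n) (Fin n) A) (X : Fin n → Fin n → A)
    (hM₁ : ∀ i : Fin n, (i : ℕ) < r → ∀ k, M i k = (-1) ^ (k : ℕ) * X i k)
    (hM₂ : ∀ i : Fin n, r ≤ (i : ℕ) → ∀ k, M i k = if k = π i then 1 else 0) :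
    M.det = (Matrix.of fun i j : {i : Fin n // (i : ℕ) < r} => X i (π j)).det := by
  have hs := Matrix.det_permute' π M
  have hN : (M.submatrix id π).det = (∏ j : {i : Fin n // (i : ℕ) < r}, (-1) ^ (π j : ℕ)) *
      (Matrix.of fun i j : {i : Fin n // (i : ℕ) < r} => X i (π j)).det := by
    rw [Matrix.twoBlockTriangular_det _ (fun i : Fin n => (i : ℕ) < r)]
    · have h1 : Matrix.toSquareBlockProp (M.submatrix id π) (fun i : Fin n => ¬ (i : ℕ) < r) =
          1 := by
        ext i j
        simp only [Matrix.toSquareBlockProp, Matrix.one_apply]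
        rw [Matrix.toBlock_apply, Matrix.submatrix_apply, id, hM₂ _ (not_lt.mp i.2)]
        simp [Subtype.ext_iff, eq_comm]
      rw [h1, Matrix.det_one, mul_one, ← Matrix.det_mul_row]
      congr 1
      ext i j
      simp only [Matrix.toSquareBlockProp]
      rw [Matrix.toBlock_apply, Matrix.submatrix_apply, id, hM₁ _ i.2]
      rfl
    · intro i hi j hj
      rw [Matrix.submatrix_apply, id, hM₂ i (not_lt.mp hi), if_neg]
      exact fun h => hi (π.injective h ▸ hj)
  have hsign : ((Equiv.Perm.sign π : ℤ) : A) =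
      ∏ j : {i : Fin n // (i : ℕ) < r}, (-1) ^ (π j : ℕ) := by
    rw [sign_of_antitone_then_monotone π r h₁ h₂, ← Finset.prod_filter,
      Finset.prod_subtype _ (fun i => Finset.mem_filter_univ i)
        (fun i : Fin n => (-1 : ℤˣ) ^ (π i : ℕ))]
    push_cast
    rfl
  have hsq : (∏ j : {i : Fin n // (i : ℕ) < r}, (-1 : A) ^ (π j : ℕ)) *
      ∏ j : {i : Fin n // (i : ℕ) < r}, (-1) ^ (π j : ℕ) = 1 := by
    rw [← Finset.prod_mul_distrib]
    exact Finset.prod_eq_one fun j _ => by rw [← pow_add, ← two_mul]; simp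
  rw [hN, hsign] at hs
  have := congrArg (fun t => (∏ j : {i : Fin n // (i : ℕ) < r}, (-1 : A) ^ (π j : ℕ)) * t) hs
  simp only [← mul_assoc, hsq, one_mul] at this
  exact this.symm

/-- Extension of a sequence to negative indices by zero. -/
def extendZero (c : ℕ → A) (k : ℤ) : A :=
  if 0 ≤ k then c k.toNat else 0

theorem extendZero_natCast (c : ℕ → A) (k : ℕ) : extendZero c k = c k := by
  simp [extendZero]

theorem extendZero_of_neg (c : ℕ → A) {k : ℤ} (hk : k < 0) : extendZero c k = 0 :=
  if_neg (not_le.mpr hk)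

theorem sum_extendZero_succ (c : ℕ → A) (l k : ℕ) :
    ∑ j ∈ Finset.range (k + 1), extendZero c ((l : ℤ) + 1 + j) *
      ((-1) ^ (k - j) * elemSeq c (k - j)) = (-1) ^ k * hookSeq c l k := by
  rw [hookSeq, Finset.mul_sum]
  refine Finset.sum_congr rfl fun j hj => ?_
  obtain ⟨m, rfl⟩ := Nat.exists_eq_add_of_le (Nat.lt_succ_iff.mp (Finset.mem_range.mp hj))
  rw [show ((l : ℤ) + 1 + j) = ((l + 1 + j : ℕ) : ℤ) by push_cast; rfl, extendZero_natCast,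
    Nat.add_sub_cancel_left, pow_add]
  have : ((-1 : A) ^ j) * (-1) ^ j = 1 := by rw [← pow_add, ← two_mul]; simp
  linear_combination (-(c (l + 1 + j) * (-1) ^ m * elemSeq c m)) * this

/-- In generating functions this is `H(z) E(-z) = 1`. -/
theorem sum_mul_elemSeq (c : ℕ → A) (hc : c 0 = 1) (k : ℕ) :
    ∑ j ∈ Finset.range (k + 1), c j * ((-1) ^ (k - j) * elemSeq c (k - j)) =
      if k = 0 then 1 else 0 := by
  cases k with
  | zero => simp [hc, elemSeq_zero]
  | succ k =>
    rw [if_neg (Nat.succ_ne_zero k), Finset.sum_range_succ']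
    have := sum_extendZero_succ c 0 k
    rw [hookSeq_zero_left] at this
    rw [hc, Nat.sub_zero, pow_succ, one_mul, mul_neg_one, neg_mul, ← this, ← sub_eq_add_neg,
      sub_eq_zero]
    refine Finset.sum_congr rfl fun j _ => ?_
    rw [Nat.add_sub_add_right, show ((0 : ℕ) : ℤ) + 1 + j = ((j + 1 : ℕ) : ℤ) by push_cast; ring,
      extendZero_natCast]

theorem sum_extendZero_neg (c : ℕ → A) (hc : c 0 = 1) (m k : ℕ) :
    ∑ j ∈ Finset.range (k + 1), extendZero c (-(m : ℤ) + j) *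
      ((-1) ^ (k - j) * elemSeq c (k - j)) = if k = m then 1 else 0 := by
  by_cases hkm : k < m
  · rw [if_neg hkm.ne]
    refine Finset.sum_eq_zero fun j hj => ?_
    rw [extendZero_of_neg, zero_mul]
    have := Finset.mem_range.mp hj
    omega
  · obtain ⟨t, rfl⟩ := Nat.exists_eq_add_of_le (not_lt.mp hkm)
    rw [add_assoc, Finset.sum_range_add, Finset.sum_eq_zero, zero_add]
    · have := sum_mul_elemSeq c hc t
      simp only [Nat.add_eq_left]
      rw [← this]
      refine Finset.sum_congr rfl fun j _ => ?_
      rw [show -(m : ℤ) + ((m + j : ℕ) : ℤ) = (j : ℤ) by push_cast; ring, extendZero_natCast,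
        Nat.add_sub_add_left]
    · intro j hj
      rw [extendZero_of_neg, zero_mul]
      have := Finset.mem_range.mp hj
      omega

theorem diag_mem_iff (μ : YoungDiagram) (i : ℕ) : (i, i) ∈ μ ↔ i < diagLen μ := by
  have hex : ∃ i, (i, i) ∉ μ := by
    refine ⟨μ.rowLen 0, fun h => ?_⟩
    have := μ.up_left_mem (Nat.zero_le _) le_rfl h
    exact lt_irrefl _ (YoungDiagram.mem_iff_lt_rowLen.mp this)
  classical
  have hiff : ∀ i, (i, i) ∈ μ ↔ i < Nat.find hex := fun i => by
    refine ⟨fun h => ?_, fun h => not_not.mp (Nat.find_min hex h)⟩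
    by_contra! hle
    exact Nat.find_spec hex (μ.up_left_mem hle hle h)
  have hcard : diagLen μ = Nat.find hex := by
    rw [diagLen, ← Finset.card_range (Nat.find hex)]
    refine Finset.card_bij (fun c _ => c.1) ?_ ?_ ?_
    · rintro ⟨a, b⟩ h
      obtain ⟨h1, rfl : a = b⟩ := Finset.mem_filter.mp h
      exact Finset.mem_range.mpr ((hiff a).mp h1)
    · rintro ⟨a, b⟩ h ⟨a', b'⟩ h' rfl
      obtain ⟨-, rfl : a = b⟩ := Finset.mem_filter.mp h
      obtain ⟨-, rfl : a = b'⟩ := Finset.mem_filter.mp h'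
      rfl
    · intro a ha
      exact ⟨(a, a), Finset.mem_filter.mpr ⟨(hiff a).mpr (Finset.mem_range.mp ha), rfl⟩, rfl⟩
  rw [hiff, hcard]

theorem lt_diagLen_iff_rowLen (μ : YoungDiagram) (i : ℕ) : i < diagLen μ ↔ i < μ.rowLen i := by
  rw [← diag_mem_iff, YoungDiagram.mem_iff_lt_rowLen]

theorem lt_diagLen_iff_colLen (μ : YoungDiagram) (i : ℕ) : i < diagLen μ ↔ i < μ.colLen i := by
  rw [← diag_mem_iff, YoungDiagram.mem_iff_lt_colLen]

theorem lt_rowLen_iff_lt_colLen (μ : YoungDiagram) (i j : ℕ) :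
    j < μ.rowLen i ↔ i < μ.colLen j := by
  rw [← YoungDiagram.mem_iff_lt_rowLen, YoungDiagram.mem_iff_lt_colLen]

theorem diagLen_le_colLen_zero (μ : YoungDiagram) : diagLen μ ≤ μ.colLen 0 := by
  by_contra! h
  have h1 := (lt_diagLen_iff_colLen μ _).mp h
  have h2 := μ.colLen_anti 0 (μ.colLen 0) (Nat.zero_le _)
  omega

/-- The columns of a Young diagram attached to its rows by the Frobenius notation: row `i` is
sent to the leg length at `(i, i)` if the diagonal box is present, and to `i - μ_i` otherwise. -/
def frobeniusCol (μ : YoungDiagram) (i : ℕ) : ℕ :=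
  if i < diagLen μ then μ.colLen i - (i + 1) else i - μ.rowLen i

theorem frobeniusCol_anti (μ : YoungDiagram) {i j : ℕ} (hij : i < j) (hj : j < diagLen μ) :
    frobeniusCol μ j < frobeniusCol μ i := by
  rw [frobeniusCol, frobeniusCol, if_pos hj, if_pos (hij.trans hj)]
  have h1 := (lt_diagLen_iff_colLen μ _).mp hj
  have h2 := μ.colLen_anti i j hij.le
  omega

theorem frobeniusCol_mono (μ : YoungDiagram) {i j : ℕ} (hij : i < j) (hi : diagLen μ ≤ i) :
    frobeniusCol μ i < frobeniusCol μ j := by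
  rw [frobeniusCol, frobeniusCol, if_neg (not_lt.mpr hi), if_neg (not_lt.mpr (hi.trans hij.le))]
  have h1 := (lt_diagLen_iff_rowLen μ i).not.mp (not_lt.mpr hi)
  have h2 := μ.rowLen_anti i j hij.le
  omega

/-- Equality would force `μ_j + μ'_i = i + j + 1` in 0-based indices. This sum is at least `i + j +
2` if the box `(j, i)` lies in `μ`, and at most `i + j` otherwise. -/
theorem frobeniusCol_ne (μ : YoungDiagram) {i j : ℕ} (hi : i < diagLen μ) (hj : diagLen μ ≤ j) :
    frobeniusCol μ i ≠ frobeniusCol μ j := by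
  rw [frobeniusCol, frobeniusCol, if_pos hi, if_neg (not_lt.mpr hj)]
  have h1 := (lt_diagLen_iff_rowLen μ j).not.mp (not_lt.mpr hj)
  have h2 := (lt_diagLen_iff_colLen μ i).mp hi
  have h3 := lt_rowLen_iff_lt_colLen μ j i
  omega

theorem frobeniusCol_injective (μ : YoungDiagram) : Function.Injective (frobeniusCol μ) := by
  have key : ∀ i j, i < j → frobeniusCol μ i ≠ frobeniusCol μ j := by
    intro i j hij
    by_cases hj : j < diagLen μ
    · exact (frobeniusCol_anti μ hij hj).ne'
    · by_cases hi : i < diagLen μ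
      · exact frobeniusCol_ne μ hi (not_lt.mp hj)
      · exact (frobeniusCol_mono μ hij (not_lt.mp hi)).ne
  intro i j h
  by_contra hne
  rcases Nat.lt_or_gt_of_ne hne with hlt | hlt
  · exact key i j hlt h
  · exact key j i hlt h.symm

theorem frobeniusCol_lt (μ : YoungDiagram) {i : ℕ} (hi : i < μ.colLen 0) :
    frobeniusCol μ i < μ.colLen 0 := by
  have h := μ.colLen_anti 0 i (Nat.zero_le _)
  rw [frobeniusCol]
  split_ifs with h'
  · omega
  · omega

/-- `frobeniusCol` as a permutation of the row indices. -/
def frobeniusPerm (μ : YoungDiagram) : Equiv.Perm (Fin (μ.colLen 0)) :=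
  Equiv.ofBijective (fun i => ⟨frobeniusCol μ i, frobeniusCol_lt μ i.2⟩)
    (Finite.injective_iff_bijective.mp fun _ _ h =>
      Fin.ext (frobeniusCol_injective μ (congrArg Fin.val h)))

theorem frobeniusPerm_val (μ : YoungDiagram) (i : Fin (μ.colLen 0)) :
    (frobeniusPerm μ i : ℕ) = frobeniusCol μ i := rfl

/-- **Giambelli formula** for the Jacobi–Trudi determinants of a sequence `c` with `c 0 = 1`. -/
theorem jacobiTrudi_eq_det_hookSeq (c : ℕ → A) (hc : c 0 = 1) (μ : YoungDiagram) :
    (Matrix.of fun i j : Fin (μ.colLen 0) =>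
      extendZero c ((μ.rowLen i : ℤ) - (i : ℤ) + (j : ℤ))).det =
    (Matrix.of fun i j : Fin (diagLen μ) =>
      hookSeq c (μ.rowLen i - (i + 1)) (μ.colLen j - (j + 1))).det := by
  set M : Matrix (Fin (μ.colLen 0)) (Fin (μ.colLen 0)) A := Matrix.of fun i j =>
    extendZero c ((μ.rowLen i : ℤ) - (i : ℤ) + (j : ℤ)) with hMdef
  -- Right multiplication by `K`, the unitriangular Toeplitz matrix of `E(-z)`, does not change the
  -- determinant. It turns the rows meeting the diagonal into signed hook functions and, since
  -- `E(-z)` inverts `H(z)`, the rows below into unit vectors at column `i - μ_i`.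
  let K : Matrix (Fin (μ.colLen 0)) (Fin (μ.colLen 0)) A := Matrix.of fun j k =>
    if j ≤ k then (-1) ^ ((k : ℕ) - j) * elemSeq c (k - j) else 0
  have hK : K.det = 1 := by
    rw [Matrix.det_of_isUpperTriangular]
    · exact Finset.prod_eq_one fun i _ => by simp [K, elemSeq_zero]
    · intro i j hij
      exact if_neg (not_le.mpr hij)
  have hMK : ∀ i k, (M * K) i k = ∑ j ∈ Finset.range ((k : ℕ) + 1),
      extendZero c ((μ.rowLen i : ℤ) - (i : ℤ) + (j : ℤ)) *
        ((-1) ^ ((k : ℕ) - j) * elemSeq c (k - j)) := by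
    intro i k
    let f : ℕ → A := fun j => if j ≤ k then
        extendZero c ((μ.rowLen i : ℤ) - (i : ℤ) + (j : ℤ)) *
        ((-1) ^ ((k : ℕ) - j) * elemSeq c (k - j)) else 0
    have h1 : (M * K) i k = ∑ j : Fin (μ.colLen 0), f j := by
      rw [Matrix.mul_apply]
      refine Finset.sum_congr rfl fun j _ => ?_
      simp only [M, K, f, Matrix.of_apply, Fin.le_def, mul_ite, mul_zero]
    rw [h1, Fin.sum_univ_eq_sum_range f, ← Finset.sum_filter]
    refine Finset.sum_congr ?_ fun _ _ => rfl
    ext j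
    have := k.2
    simp only [Finset.mem_filter, Finset.mem_range]
    omega
  have hdet : M.det = (M * K).det := by rw [Matrix.det_mul, hK, mul_one]
  rw [hdet, det_of_unit_rows (frobeniusPerm μ) (diagLen μ)
    (fun i j hij hj => frobeniusCol_anti μ hij hj)
    (fun i j hij hi => frobeniusCol_mono μ hij hi) (M * K)
    (fun i k => hookSeq c (μ.rowLen i - (i + 1)) k)]
  · let e : Fin (diagLen μ) ≃ {i : Fin (μ.colLen 0) // (i : ℕ) < diagLen μ} :=
      { toFun := fun i => ⟨⟨i, i.2.trans_le (diagLen_le_colLen_zero μ)⟩, i.2⟩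
        invFun := fun i => ⟨i.1, i.2⟩
        left_inv := fun _ => rfl
        right_inv := fun _ => rfl }
    rw [← Matrix.det_submatrix_equiv_self e]
    congr 1
    ext i j
    simp only [Matrix.submatrix_apply, Matrix.of_apply, frobeniusPerm_val, e, Equiv.coe_fn_mk,
      frobeniusCol, if_pos j.2]
  · intro i hi k
    have h := (lt_diagLen_iff_rowLen μ i).mp hi
    rw [hMK, ← sum_extendZero_succ]
    refine Finset.sum_congr rfl fun j _ => ?_
    congr 2
    omega
  · intro i hi k
    have h := (lt_diagLen_iff_rowLen μ i).not.mp (not_lt.mpr hi)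
    rw [hMK]
    have h2 := sum_extendZero_neg c hc ((i : ℕ) - μ.rowLen i) k
    have h3 : (k = frobeniusPerm μ i) ↔ ((k : ℕ) = (i : ℕ) - μ.rowLen i) := by
      rw [Fin.ext_iff, frobeniusPerm_val, frobeniusCol, if_neg (not_lt.mpr hi)]
    simp only [h3]
    rw [← h2]
    refine Finset.sum_congr rfl fun j _ => ?_
    congr 2
    omega

end ScalarGiambelli

/-! ### Schur polynomials and characters as determinants of hooks -/

section Schur

theorem completeSym_eq_extendZero (y : ℕ → ℂ) :
    completeSym y = extendZero (newtonSeq fun k => (k : ℂ) * y k) := by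
  funext k
  by_cases hk : 0 ≤ k
  · lift k to ℕ using hk
    rw [completeSym_natCast, extendZero_natCast]
  · rw [extendZero_of_neg _ (not_le.mp hk), completeSym, if_neg hk]

theorem schur_eq_det_hookSeq (μ : YoungDiagram) (y : ℕ → ℂ) :
    schur μ y = (Matrix.of fun i j : Fin (diagLen μ) =>
      hookSeq (newtonSeq fun k => (k : ℂ) * y k)
        (μ.rowLen i - (i + 1)) (μ.colLen j - (j + 1))).det := by
  rw [schur, completeSym_eq_extendZero]
  exact jacobiTrudi_eq_det_hookSeq _ (newtonSeq_zero _) μ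

theorem mem_hook_iff (l k i j : ℕ) :
    (i, j) ∈ hook l k ↔ (i = 0 ∧ j ≤ l) ∨ (j = 0 ∧ i ≤ k) := by
  rw [hook, YoungDiagram.mem_ofRowLens]
  cases i with
  | zero => simp; omega
  | succ i =>
    simp
    omega

theorem rowLen_hook_zero (l k : ℕ) : (hook l k).rowLen 0 = l + 1 := by
  refine eq_of_forall_lt_iff fun j => ?_
  rw [← YoungDiagram.mem_iff_lt_rowLen, mem_hook_iff]
  omega

theorem colLen_hook_zero (l k : ℕ) : (hook l k).colLen 0 = k + 1 := by
  refine eq_of_forall_lt_iff fun j => ?_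
  rw [← YoungDiagram.mem_iff_lt_colLen, mem_hook_iff]
  omega

theorem diagLen_hook (l k : ℕ) : diagLen (hook l k) = 1 := by
  refine eq_of_forall_lt_iff fun j => ?_
  rw [← diag_mem_iff, mem_hook_iff]
  omega

theorem diagLen_pos {μ : YoungDiagram} (hμ : μ ≠ ⊥) : 0 < diagLen μ := by
  rw [← diag_mem_iff]
  by_contra h
  refine hμ (YoungDiagram.ext (Finset.eq_empty_of_forall_notMem ?_))
  rintro ⟨i, j⟩ hij
  exact h (μ.up_left_mem (Nat.zero_le i) (Nat.zero_le j) ((YoungDiagram.mem_cells _).mp hij))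

theorem schur_hook (l k : ℕ) (y : ℕ → ℂ) :
    schur (hook l k) y = hookSeq (newtonSeq fun k => (k : ℂ) * y k) l k := by
  have key : ∀ (d : ℕ) (hd : d = 1) (f : Fin d → Fin d → ℂ),
      (Matrix.of f).det = f ⟨0, by omega⟩ ⟨0, by omega⟩ := by
    rintro d rfl f
    simp
  rw [schur_eq_det_hookSeq, key _ (diagLen_hook l k)]
  simp [rowLen_hook_zero, colLen_hook_zero]

theorem schur_bot (y : ℕ → ℂ) : schur ⊥ y = 1 := by
  have : (⊥ : YoungDiagram).colLen 0 = 0 := by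
    refine Nat.eq_zero_of_not_pos fun h => ?_
    exact YoungDiagram.notMem_bot _ (YoungDiagram.mem_iff_lt_colLen.mpr h)
  have key : ∀ (d : ℕ) (hd : d = 0) (f : Fin d → Fin d → ℂ), (Matrix.of f).det = 1 := by
    rintro d rfl f
    simp
  exact key _ this _

/-- The complete symmetric functions of the eigenvalues of `h`. -/
def completeSeq {N : ℕ} (h : Matrix (Fin N) (Fin N) ℂ) : ℕ → ℂ :=
  newtonSeq fun k => (h ^ k).trace

theorem newtonSeq_times {N : ℕ} (h : Matrix (Fin N) (Fin N) ℂ) :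
    (newtonSeq fun k => (k : ℂ) * times h k) = completeSeq h := by
  funext m
  refine newtonSeq_unique (fun k => (h ^ k).trace) _ (newtonSeq_zero _) (fun m => ?_) m
  rw [newtonSeq_succ]
  refine Finset.sum_congr rfl fun j _ => ?_
  rw [times, mul_div_cancel₀]
  exact_mod_cast Nat.succ_ne_zero j

theorem chi_eq_det {N : ℕ} (μ : YoungDiagram) (h : Matrix (Fin N) (Fin N) ℂ) :
    chi μ h = (Matrix.of fun i j : Fin (diagLen μ) => hookSeq (completeSeq h)
        (μ.rowLen i - (i + 1)) (μ.colLen j - (j + 1))).det := by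
  rw [chi, schur_eq_det_hookSeq, newtonSeq_times]

theorem chi_hook {N : ℕ} (l k : ℕ) (h : Matrix (Fin N) (Fin N) ℂ) :
    chi (hook l k) h = hookSeq (completeSeq h) l k := by
  rw [chi, schur_hook, newtonSeq_times]

theorem chi_bot {N : ℕ} (h : Matrix (Fin N) (Fin N) ℂ) : chi ⊥ h = 1 := schur_bot _

end Schur

/-! ### Operator-valued polynomials, one-site operators and exchanges of sites -/

section PolynomialOperators

/-- Polynomial functions on the space of `N × N` matrices. -/
abbrev TwistRing (N : ℕ) : Type := MvPolynomial (Fin N × Fin N) ℂ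

/-- Polynomial functions of the twist matrix with values in `End ((ℂ^N)^{⊗ n})`. -/
abbrev PolyOp (N n : ℕ) : Type := Matrix (Fin n → Fin N) (Fin n → Fin N) (TwistRing N)

variable {N n : ℕ}

/-- The matrix `M` acting in the `i`-th tensor factor. -/
def site (i : Fin n) (M : Matrix (Fin N) (Fin N) (TwistRing N)) : PolyOp N n :=
  Matrix.of fun u v => if ∀ j, j ≠ i → u j = v j then M (u i) (v i) else 0

theorem site_apply (i : Fin n) (M : Matrix (Fin N) (Fin N) (TwistRing N)) (u v : Fin n → Fin N) :
    site i M u v = if ∀ j, j ≠ i → u j = v j then M (u i) (v i) else 0 := rfl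

theorem site_add (i : Fin n) (M M' : Matrix (Fin N) (Fin N) (TwistRing N)) :
    site i (M + M') = site i M + site i M' := by
  ext1 u v
  simp only [site_apply, Matrix.add_apply]
  split_ifs <;> simp

theorem site_smul (i : Fin n) (r : TwistRing N) (M : Matrix (Fin N) (Fin N) (TwistRing N)) :
    site i (r • M) = r • site i M := by
  ext1 u v
  simp only [site_apply, Matrix.smul_apply]
  split_ifs <;> simp

theorem site_one (i : Fin n) : site i (1 : Matrix (Fin N) (Fin N) (TwistRing N)) = 1 := by
  ext1 u v
  simp only [site_apply, Matrix.one_apply]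
  by_cases h : u = v
  · simp [h]
  · rw [if_neg h]
    split_ifs with h1 h2
    · exact absurd (funext fun j => if hj : j = i then hj ▸ h2 else h1 j hj) h
    · rfl
    · rfl

/-- Only the intermediate states that differ from `u` at most at site `i` contribute, so the sum
collapses to one over `Fin N`. -/
theorem site_mul (i : Fin n) (M M' : Matrix (Fin N) (Fin N) (TwistRing N)) :
    site i (M * M') = site i M * site i M' := by
  ext1 u v
  rw [Matrix.mul_apply, ← Fintype.sum_of_injective (fun c => Function.update u i c)
    (Function.update_injective u i)
    (fun c => if ∀ j, j ≠ i → u j = v j then M (u i) c * M' c (v i) else 0)]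
  · rw [site_apply, Matrix.mul_apply]
    split_ifs <;> simp
  · intro w hw
    rw [site_apply, if_neg, zero_mul]
    intro h
    exact hw ⟨w i, funext fun j => by
      by_cases hj : j = i
      · subst hj; simp
      · simp [hj, h j hj]⟩
  · intro c
    have h1 : ∀ j, j ≠ i → u j = Function.update u i c j := fun j hj => by simp [hj]
    have h2 : (∀ j, j ≠ i → Function.update u i c j = v j) ↔ ∀ j, j ≠ i → u j = v j :=
      forall₂_congr fun j hj => by simp [hj]
    simp only [site_apply, if_pos h1, h2, Function.update_self, mul_ite, mul_zero]

theorem site_mul_site_apply {i j : Fin n} (hij : i ≠ j)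
    (M M' : Matrix (Fin N) (Fin N) (TwistRing N)) (u v : Fin n → Fin N) :
    (site i M * site j M') u v =
      if ∀ k, k ≠ i → k ≠ j → u k = v k then M (u i) (v i) * M' (u j) (v j) else 0 := by
  rw [Matrix.mul_apply, Fintype.sum_eq_single (Function.update u i (v i))]
  · have h1 : ∀ k, k ≠ i → u k = Function.update u i (v i) k := fun k hk => by simp [hk]
    have h2 : (∀ k, k ≠ j → Function.update u i (v i) k = v k) ↔
        ∀ k, k ≠ i → k ≠ j → u k = v k := by
      refine forall_congr' fun k => ?_
      by_cases hk : k = i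
      · subst hk; simp
      · simp [hk]
    simp only [site_apply, if_pos h1, h2, Function.update_self,
      Function.update_of_ne hij.symm, mul_ite, mul_zero]
  · intro w hw
    by_cases h1 : ∀ k, k ≠ i → u k = w k
    · rw [site_apply j, if_neg, mul_zero]
      intro h2
      refine hw (funext fun k => ?_)
      by_cases hk : k = i
      · subst hk; simp [h2 k hij]
      · simp [hk, h1 k hk]
    · rw [site_apply i, if_neg h1, zero_mul]

theorem site_commute {i j : Fin n} (hij : i ≠ j)
    (M M' : Matrix (Fin N) (Fin N) (TwistRing N)) : Commute (site i M) (site j M') := by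
  ext1 u v
  rw [site_mul_site_apply hij, site_mul_site_apply hij.symm]
  have : (∀ k, k ≠ i → k ≠ j → u k = v k) ↔ ∀ k, k ≠ j → k ≠ i → u k = v k :=
    forall_congr' fun k => forall_comm
  simp only [this, mul_comm]

/-- The operator exchanging the tensor factors `i` and `j`. -/
def siteSwap (i j : Fin n) : PolyOp N n :=
  Matrix.of fun u v => if u = v ∘ Equiv.swap i j then 1 else 0

theorem comp_swap_comp_swap (i j : Fin n) (u : Fin n → Fin N) :
    (u ∘ Equiv.swap i j) ∘ Equiv.swap i j = u := by
  funext k; simp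

theorem eq_comp_swap_iff (i j : Fin n) (u v : Fin n → Fin N) :
    u = v ∘ Equiv.swap i j ↔ u ∘ Equiv.swap i j = v := by
  constructor
  · rintro rfl; exact comp_swap_comp_swap i j v
  · rintro rfl; exact (comp_swap_comp_swap i j u).symm

theorem siteSwap_mul_apply (i j : Fin n) (F : PolyOp N n) (u v : Fin n → Fin N) :
    (siteSwap i j * F : PolyOp N n) u v = F (u ∘ Equiv.swap i j) v := by
  simp [Matrix.mul_apply, siteSwap, eq_comp_swap_iff]

theorem mul_siteSwap_apply (i j : Fin n) (F : PolyOp N n) (u v : Fin n → Fin N) :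
    (F * siteSwap i j : PolyOp N n) u v = F u (v ∘ Equiv.swap i j) := by
  simp [Matrix.mul_apply, siteSwap]

theorem siteSwap_mul_self (i j : Fin n) : (siteSwap i j : PolyOp N n) * siteSwap i j = 1 := by
  ext1 u v
  rw [siteSwap_mul_apply, Matrix.one_apply]
  simp only [siteSwap, Matrix.of_apply]
  refine if_congr ?_ rfl rfl
  rw [eq_comp_swap_iff, comp_swap_comp_swap]

theorem siteSwap_comm (i j : Fin n) : (siteSwap i j : PolyOp N n) = siteSwap j i := by
  rw [siteSwap, siteSwap, Equiv.swap_comm]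

theorem siteSwap_mul_site (i j : Fin n) (M : Matrix (Fin N) (Fin N) (TwistRing N)) :
    siteSwap i j * site i M = site j M * siteSwap i j := by
  ext1 u v
  rw [siteSwap_mul_apply, mul_siteSwap_apply, site_apply, site_apply]
  have h : (∀ k, k ≠ i → (u ∘ Equiv.swap i j) k = v k) ↔
      ∀ k, k ≠ j → u k = (v ∘ Equiv.swap i j) k := by
    rw [← (Equiv.swap i j).forall_congr_right]
    refine forall_congr' fun k => ?_
    have : Equiv.swap i j k ≠ i ↔ k ≠ j := by
      rw [Ne, Equiv.swap_apply_eq_iff, Equiv.swap_apply_left]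
    simp [this]
  simp only [Function.comp_apply] at h
  simp only [h, Function.comp_apply, Equiv.swap_apply_left, Equiv.swap_apply_right]

theorem siteSwap_commute_site {i j k : Fin n} (hi : k ≠ i) (hj : k ≠ j)
    (M : Matrix (Fin N) (Fin N) (TwistRing N)) : Commute (siteSwap i j) (site k M) := by
  ext1 u v
  rw [siteSwap_mul_apply, mul_siteSwap_apply, site_apply, site_apply]
  have h : (∀ m, m ≠ k → (u ∘ Equiv.swap i j) m = v m) ↔
      ∀ m, m ≠ k → u m = (v ∘ Equiv.swap i j) m := by
    rw [← (Equiv.swap i j).forall_congr_right]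
    refine forall_congr' fun m => ?_
    have : Equiv.swap i j m ≠ k ↔ m ≠ k := by
      rw [Ne, Equiv.swap_apply_eq_iff, Equiv.swap_apply_of_ne_of_ne hi hj]
    simp [this]
  simp only [Function.comp_apply] at h
  simp only [h, Function.comp_apply, Equiv.swap_apply_of_ne_of_ne hi hj]

/-- The matrix unit `e_{ab}` at site `i`. -/
def polyUnit (i : Fin n) (a b : Fin N) : PolyOp N n := site i (Matrix.single a b 1)

theorem sum_polyUnit_mul {i j : Fin n} (hij : i ≠ j) :
    ∑ a : Fin N, ∑ b : Fin N, polyUnit i a b * polyUnit j b a = siteSwap i j := by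
  ext1 u v
  simp only [Matrix.sum_apply, polyUnit, site_mul_site_apply hij]
  have h : (u = v ∘ Equiv.swap i j) ↔
      (∀ k, k ≠ i → k ≠ j → u k = v k) ∧ u i = v j ∧ u j = v i := by
    constructor
    · rintro rfl
      refine ⟨fun k hi hj => ?_, ?_, ?_⟩ <;> simp
      rw [Equiv.swap_apply_of_ne_of_ne hi hj]
    · rintro ⟨h1, h2, h3⟩
      funext k
      by_cases hi : k = i
      · subst hi; simp [h2]
      · by_cases hj : k = j
        · subst hj; simp [h3]
        · simp [Equiv.swap_apply_of_ne_of_ne hi hj, h1 k hi hj]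
  simp only [siteSwap, Matrix.of_apply, h]
  by_cases h1 : ∀ k, k ≠ i → k ≠ j → u k = v k
  · have h2 : ∀ a b : Fin N, (Matrix.single a b (1 : TwistRing N)) (u i) (v i) *
        (Matrix.single b a (1 : TwistRing N)) (u j) (v j) =
        if b = v i then (if a = u i then (if u i = v j ∧ u j = v i then 1 else 0) else 0)
          else 0 := by
      intro a b
      rw [Matrix.single_apply, Matrix.single_apply]
      split_ifs <;> simp_all
    simp only [if_pos h1, h2, Finset.sum_ite_eq', Finset.mem_univ, if_true]
    exact if_congr ⟨fun h => ⟨h1, h⟩, fun h => h.2⟩ rfl rfl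
  · simp only [if_neg h1, Finset.sum_const_zero]
    rw [if_neg fun h => h1 h.1]

end PolynomialOperators

/-! ### The matrix derivative, its Leibniz rule and gradients -/

section MatrixDerivative

variable {N n : ℕ}

/-- The entrywise partial derivative `∂/∂h_{ba}` of a matrix of polynomials. -/
def entryDeriv {m : Type*} (b a : Fin N) :
    Matrix m m (TwistRing N) →ₗ[ℂ] Matrix m m (TwistRing N) :=
  (MvPolynomial.pderiv (b, a)).toLinearMap.mapMatrix

theorem entryDeriv_apply {m : Type*} (b a : Fin N) (F : Matrix m m (TwistRing N)) (u v : m) :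
    entryDeriv b a F u v = MvPolynomial.pderiv (b, a) (F u v) := rfl

theorem entryDeriv_mul {m : Type*} [Fintype m] (b a : Fin N) (F G : Matrix m m (TwistRing N)) :
    entryDeriv b a (F * G) = entryDeriv b a F * G + F * entryDeriv b a G := by
  ext1 u v
  simp only [entryDeriv_apply, Matrix.mul_apply, Matrix.add_apply, map_sum, Derivation.leibniz,
    ← Finset.sum_add_distrib, smul_eq_mul]
  exact Finset.sum_congr rfl fun _ _ => by ring

theorem entryDeriv_comm {m : Type*} (b a b' a' : Fin N) (F : Matrix m m (TwistRing N)) :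
    entryDeriv b a (entryDeriv b' a' F) = entryDeriv b' a' (entryDeriv b a F) := by
  ext1 u v
  simp only [entryDeriv_apply]
  let D (p : Fin N × Fin N) : Derivation ℂ (TwistRing N) (TwistRing N) := MvPolynomial.pderiv p
  have h : ⁅D (b, a), D (b', a')⁆ = 0 := by
    refine MvPolynomial.derivation_ext fun i => ?_
    simp [D, Derivation.commutator_apply, MvPolynomial.pderiv_X, Pi.single_apply, apply_ite]
  have h2 := congrArg (fun δ => δ (F u v)) h
  simpa [D, Derivation.commutator_apply, sub_eq_zero] using h2

theorem entryDeriv_one {m : Type*} [DecidableEq m] (b a : Fin N) :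
    entryDeriv b a (1 : Matrix m m (TwistRing N)) = 0 := by
  ext1 u v
  rw [entryDeriv_apply, Matrix.one_apply]
  split_ifs <;> simp

theorem entryDeriv_site (b a : Fin N) (i : Fin n) (M : Matrix (Fin N) (Fin N) (TwistRing N)) :
    entryDeriv b a (site i M) = site i (entryDeriv b a M) := by
  ext1 u v
  rw [entryDeriv_apply, site_apply, site_apply]
  split_ifs <;> simp [entryDeriv_apply]

theorem entryDeriv_single (b a c d : Fin N) :
    entryDeriv b a (Matrix.single c d (1 : TwistRing N)) = 0 := by
  ext1 u v
  rw [entryDeriv_apply, Matrix.single_apply]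
  split_ifs <;> simp

theorem entryDeriv_polyUnit (b a c d : Fin N) (i : Fin n) :
    entryDeriv b a (polyUnit i c d) = 0 := by
  rw [polyUnit, entryDeriv_site, entryDeriv_single]
  ext1 u v
  simp [site_apply]

theorem entryDeriv_siteSwap (b a : Fin N) (i j : Fin n) :
    entryDeriv b a (siteSwap i j : PolyOp N n) = 0 := by
  ext1 u v
  simp only [entryDeriv_apply, siteSwap, Matrix.of_apply]
  split_ifs <;> simp

/-- The matrix derivative `F ↦ ∑_{a,b} e_{ab}^{(i)} ∂F/∂h_{ba}` on polynomial functions. -/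
def polyDeriv (i : Fin n) : PolyOp N n →ₗ[ℂ] PolyOp N n :=
  ∑ a : Fin N, ∑ b : Fin N, LinearMap.mulLeft ℂ (polyUnit i a b) ∘ₗ entryDeriv b a

theorem polyDeriv_apply (i : Fin n) (F : PolyOp N n) :
    polyDeriv i F = ∑ a : Fin N, ∑ b : Fin N, polyUnit i a b * entryDeriv b a F := by
  simp [polyDeriv, LinearMap.sum_apply]

/-- `F` acts trivially in the tensor factor `i`: it commutes with the matrix units there. -/
def TrivialAt (i : Fin n) (F : PolyOp N n) : Prop :=
  ∀ a b : Fin N, Commute (polyUnit i a b) F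

theorem TrivialAt.mul {i : Fin n} {F G : PolyOp N n} (hF : TrivialAt i F) (hG : TrivialAt i G) :
    TrivialAt i (F * G) := fun a b => (hF a b).mul_right (hG a b)

theorem TrivialAt.add {i : Fin n} {F G : PolyOp N n} (hF : TrivialAt i F) (hG : TrivialAt i G) :
    TrivialAt i (F + G) := fun a b => (hF a b).add_right (hG a b)

theorem TrivialAt.sum {ι : Type*} {i : Fin n} (s : Finset ι) {F : ι → PolyOp N n}
    (hF : ∀ k ∈ s, TrivialAt i (F k)) : TrivialAt i (∑ k ∈ s, F k) := fun a b =>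
  Commute.sum_right _ _ _ fun k hk => hF k hk a b

theorem TrivialAt.smul {i : Fin n} {F : PolyOp N n} (hF : TrivialAt i F) (c : ℂ) :
    TrivialAt i (c • F) := fun a b => (hF a b).smul_right c

theorem TrivialAt.smul_ring {i : Fin n} {F : PolyOp N n} (hF : TrivialAt i F)
    (c : TwistRing N) : TrivialAt i (c • F) := fun a b => (hF a b).smul_right c

theorem TrivialAt.one (i : Fin n) : TrivialAt i (1 : PolyOp N n) := fun _ _ =>
  Commute.one_right _

theorem TrivialAt.site {i j : Fin n} (hij : i ≠ j) (M : Matrix (Fin N) (Fin N) (TwistRing N)) :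
    TrivialAt i (site j M) := fun _ _ => site_commute hij _ _

theorem TrivialAt.siteSwap {i j k : Fin n} (hi : k ≠ i) (hj : k ≠ j) :
    TrivialAt k (siteSwap i j : PolyOp N n) := fun _ _ => (siteSwap_commute_site hi hj _).symm

theorem TrivialAt.entryDeriv {i : Fin n} {F : PolyOp N n} (hF : TrivialAt i F) (b a : Fin N) :
    TrivialAt i (entryDeriv b a F) := fun c d => by
  have := congrArg (Gaudin.entryDeriv b a) (hF c d).eq
  rwa [entryDeriv_mul, entryDeriv_mul, entryDeriv_polyUnit, zero_mul, mul_zero, zero_add,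
    add_zero] at this

theorem TrivialAt.polyDeriv {i j : Fin n} (hij : i ≠ j) {F : PolyOp N n} (hF : TrivialAt i F) :
    TrivialAt i (polyDeriv j F) := by
  rw [polyDeriv_apply]
  exact TrivialAt.sum _ fun a _ => TrivialAt.sum _ fun b _ =>
    (TrivialAt.site hij _).mul (hF.entryDeriv b a)

/-- The matrix unit multiplies from the left, so in the second term it has to pass through `F`; this
is where triviality of the left factor enters. -/
theorem polyDeriv_mul (i : Fin n) {F : PolyOp N n} (hF : TrivialAt i F) (G : PolyOp N n) :
    polyDeriv i (F * G) = polyDeriv i F * G + F * polyDeriv i G := by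
  simp only [polyDeriv_apply, Finset.sum_mul, Finset.mul_sum, ← Finset.sum_add_distrib,
    entryDeriv_mul, mul_add]
  refine Finset.sum_congr rfl fun a _ => Finset.sum_congr rfl fun b _ => ?_
  rw [← mul_assoc, ← mul_assoc, ← mul_assoc, (hF a b).eq]

theorem polyDeriv_one (i : Fin n) : polyDeriv i (1 : PolyOp N n) = 0 := by
  rw [polyDeriv_apply]
  refine Finset.sum_eq_zero fun a _ => Finset.sum_eq_zero fun b _ => ?_
  rw [entryDeriv_one, mul_zero]

theorem polyDeriv_comm {i j : Fin n} (hij : i ≠ j) (F : PolyOp N n) :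
    polyDeriv i (polyDeriv j F) = polyDeriv j (polyDeriv i F) := by
  have key : ∀ k l : Fin n, polyDeriv k (polyDeriv l F) = ∑ a : Fin N, ∑ b : Fin N,
      ∑ c : Fin N, ∑ d : Fin N, polyUnit k a b * polyUnit l c d *
        entryDeriv b a (entryDeriv d c F) := by
    intro k l
    rw [polyDeriv_apply]
    refine Finset.sum_congr rfl fun a _ => Finset.sum_congr rfl fun b _ => ?_
    rw [polyDeriv_apply, map_sum, Finset.mul_sum]
    refine Finset.sum_congr rfl fun c _ => ?_
    rw [map_sum, Finset.mul_sum]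
    refine Finset.sum_congr rfl fun d _ => ?_
    rw [entryDeriv_mul, entryDeriv_polyUnit, zero_mul, zero_add, mul_assoc]
  rw [key, key]
  calc _ = ∑ p : Fin N × Fin N, ∑ q : Fin N × Fin N, polyUnit i p.1 p.2 * polyUnit j q.1 q.2 *
        entryDeriv p.2 p.1 (entryDeriv q.2 q.1 F) := by
        simp only [Fintype.sum_prod_type]
    _ = ∑ q : Fin N × Fin N, ∑ p : Fin N × Fin N, polyUnit j q.1 q.2 * polyUnit i p.1 p.2 *
        entryDeriv q.2 q.1 (entryDeriv p.2 p.1 F) := by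
        rw [Finset.sum_comm]
        refine Finset.sum_congr rfl fun q _ => Finset.sum_congr rfl fun p _ => ?_
        rw [entryDeriv_comm, polyUnit, polyUnit, (site_commute hij _ _).eq]
    _ = _ := by simp only [Fintype.sum_prod_type]

/-- The gradient `(∂r/∂h_{ba})_{ab}` of a polynomial function. -/
def grad : TwistRing N →ₗ[ℂ] Matrix (Fin N) (Fin N) (TwistRing N) where
  toFun r := Matrix.of fun a b => MvPolynomial.pderiv (b, a) r
  map_add' r s := by ext1 a b; simp
  map_smul' c r := by ext1 a b; simp

theorem grad_apply (r : TwistRing N) (a b : Fin N) :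
    grad r a b = MvPolynomial.pderiv (b, a) r := rfl

theorem grad_mul (r s : TwistRing N) : grad (r * s) = r • grad s + s • grad r := by
  ext1 a b
  simp [grad_apply, Derivation.leibniz]

theorem grad_one : grad (1 : TwistRing N) = 0 := by
  ext1 a b
  simp [grad_apply]

theorem matrix_eq_sum_single (M : Matrix (Fin N) (Fin N) (TwistRing N)) :
    M = ∑ a : Fin N, ∑ b : Fin N, M a b • Matrix.single a b 1 := by
  conv_lhs => rw [Matrix.matrix_eq_sum_single M]
  simp

theorem site_zero (i : Fin n) : site i (0 : Matrix (Fin N) (Fin N) (TwistRing N)) = 0 := by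
  ext1 u v
  simp [site_apply]

theorem site_sum {ι : Type*} (i : Fin n) (s : Finset ι)
    (f : ι → Matrix (Fin N) (Fin N) (TwistRing N)) :
    site i (∑ k ∈ s, f k) = ∑ k ∈ s, site i (f k) :=
  map_sum (AddMonoidHom.mk' (site i) (site_add i)) f s

theorem polyDeriv_smul_one (i : Fin n) (r : TwistRing N) :
    polyDeriv i (r • (1 : PolyOp N n)) = site i (grad r) := by
  rw [matrix_eq_sum_single (grad r), site_sum, polyDeriv_apply]
  refine Finset.sum_congr rfl fun a _ => ?_
  rw [site_sum]
  refine Finset.sum_congr rfl fun b _ => ?_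
  have : entryDeriv b a (r • (1 : PolyOp N n)) = grad r a b • 1 := by
    ext1 u v
    simp only [entryDeriv_apply, Matrix.smul_apply, Matrix.one_apply, grad_apply]
    split_ifs <;> simp
  rw [this, mul_smul_comm, mul_one, site_smul, polyUnit]

/-- The generic twist matrix. -/
def generic (N : ℕ) : Matrix (Fin N) (Fin N) (TwistRing N) :=
  Matrix.of fun a b => MvPolynomial.X (a, b)

theorem entryDeriv_generic (b a : Fin N) :
    entryDeriv b a (generic N) = Matrix.single b a 1 := by
  ext1 u v
  rw [entryDeriv_apply, generic, Matrix.of_apply, MvPolynomial.pderiv_X, Matrix.single_apply,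
    Pi.single_apply]
  simp [Prod.ext_iff, eq_comm]

/-- The derivative is `∑ e_{ab} ⊗ e_{ba}`, the permutation operator. This is the source of all
exchanges of sites in the proof. -/
theorem polyDeriv_site_generic {i j : Fin n} (hij : i ≠ j) :
    polyDeriv i (site j (generic N)) = siteSwap i j := by
  rw [← sum_polyUnit_mul hij, polyDeriv_apply]
  refine Finset.sum_congr rfl fun a _ => Finset.sum_congr rfl fun b _ => ?_
  rw [entryDeriv_site, entryDeriv_generic, polyUnit, polyUnit]

/-- Cyclicity of the trace moves every differentiated factor to the front. The commuting factor `Y`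
is there for the induction, in which it absorbs one more power of the generic matrix. -/
theorem trace_entryDeriv_pow_mul (b a : Fin N) (k : ℕ)
    (Y : Matrix (Fin N) (Fin N) (TwistRing N)) (hY : Commute (generic N) Y) :
    (entryDeriv b a (generic N ^ (k + 1)) * Y).trace =
      ((k : ℂ) + 1) • (Matrix.single b a 1 * (generic N ^ k * Y)).trace := by
  induction k generalizing Y with
  | zero => simp [entryDeriv_generic]
  | succ k ih =>
    rw [pow_succ, entryDeriv_mul, add_mul, Matrix.trace_add, mul_assoc,
      ih _ ((Commute.refl _).mul_right hY), entryDeriv_generic, mul_assoc,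
      Matrix.trace_mul_comm (generic N ^ (k + 1)), mul_assoc, ← mul_assoc (generic N ^ k),
      ← pow_succ, ← (hY.pow_left (k + 1)).eq]
    push_cast
    rw [add_smul (_ + 1) (1 : ℂ), one_smul]

theorem grad_trace_pow (k : ℕ) :
    grad ((generic N ^ (k + 1)).trace) = ((k : ℂ) + 1) • generic N ^ k := by
  ext1 a b
  have h1 : grad ((generic N ^ (k + 1)).trace) a b =
      (entryDeriv b a (generic N ^ (k + 1))).trace := by
    simp only [grad_apply, Matrix.trace, map_sum, Matrix.diag_apply, entryDeriv_apply]
  have h2 := trace_entryDeriv_pow_mul b a k 1 (Commute.one_right _)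
  rw [mul_one, mul_one] at h2
  rw [h1, h2, Matrix.smul_apply]
  congr 1
  rw [Matrix.trace_single_mul]
  simp

end MatrixDerivative

/-! ### Gradients of complete, elementary and hook characters -/

section GradientRecursions

variable {N : ℕ}

/-- The complete symmetric functions of the generic twist matrix. -/
def completePoly (N : ℕ) : ℕ → TwistRing N :=
  newtonSeq fun k => (generic N ^ k).trace

/-- The elementary symmetric functions of the generic twist matrix. -/
def elemPoly (N : ℕ) : ℕ → TwistRing N := elemSeq (completePoly N)

/-- The hook characters of the generic twist matrix. -/
def hookPoly (N : ℕ) : ℕ → ℕ → TwistRing N := hookSeq (completePoly N)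

theorem grad_newton (m : ℕ) : ((m : ℂ) + 1) • grad (completePoly N (m + 1)) =
    ∑ j ∈ Finset.range (m + 1), (((generic N ^ (j + 1)).trace) • grad (completePoly N (m - j)) +
      completePoly N (m - j) • ((j : ℂ) + 1) • generic N ^ j) := by
  rw [← map_smul, completePoly, newtonSeq_succ, map_sum]
  refine Finset.sum_congr rfl fun j _ => ?_
  rw [grad_mul, grad_trace_pow]

/-- The sum `∑_{j < m} h_{m-1-j} H^j`. -/
def gradSum (N m : ℕ) : Matrix (Fin N) (Fin N) (TwistRing N) :=
  ∑ j ∈ Finset.range m, completePoly N (m - 1 - j) • generic N ^ j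

theorem gradSum_succ (m : ℕ) :
    gradSum N (m + 1) = completePoly N m • 1 + generic N * gradSum N m := by
  rw [gradSum, Finset.sum_range_succ', add_comm, gradSum, Finset.mul_sum]
  congr 1
  refine Finset.sum_congr rfl fun j _ => ?_
  rw [mul_smul_comm, ← pow_succ', show m + 1 - 1 - (j + 1) = m - 1 - j by omega]

/-- In the differentiated Newton identity, each gradient is replaced by `h + H ∂h` for the previous
index. The scalar terms add up by Newton's identity, and the terms with a factor `H` reproduce `H`
times the differentiated identity one degree lower, plus one extra `H ∂h` and one extra scalar term.
-/
theorem grad_completePoly_eq_gradSum (m : ℕ) : grad (completePoly N m) = gradSum N m := by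
  induction m using Nat.strong_induction_on with
  | _ m ih =>
    cases m with
    | zero => rw [completePoly, newtonSeq_zero, grad_one, gradSum, Finset.sum_range_zero]
    | succ m =>
      have hm : ((m : ℂ) + 1) ≠ 0 := by exact_mod_cast Nat.succ_ne_zero m
      refine smul_right_injective _ hm ?_
      simp only
      rw [grad_newton, gradSum_succ, Finset.sum_add_distrib]
      cases m with
      | zero =>
        simp [gradSum, completePoly, newtonSeq_zero, grad_one]
      | succ m =>
        rw [Finset.sum_range_succ, Nat.sub_self]
        have h0 : grad (completePoly N 0) = 0 := by
          rw [completePoly, newtonSeq_zero, grad_one]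
        rw [h0, smul_zero, add_zero, Finset.sum_range_succ' (fun j => completePoly N (m + 1 - j) •
          ((j : ℂ) + 1) • generic N ^ j)]
        have h1 : ∀ j ∈ Finset.range (m + 1), (generic N ^ (j + 1)).trace •
            grad (completePoly N (m + 1 - j)) =
            ((generic N ^ (j + 1)).trace * completePoly N (m - j)) • 1 +
              generic N * ((generic N ^ (j + 1)).trace • grad (completePoly N (m - j))) := by
          intro j hj
          have hj' := Finset.mem_range.mp hj
          rw [ih _ (by omega), ih _ (by omega), show m + 1 - j = (m - j) + 1 by omega,
            gradSum_succ, smul_add, smul_smul, mul_smul_comm]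
        have h2 : ∀ j ∈ Finset.range (m + 1), completePoly N (m + 1 - (j + 1)) •
            (((j + 1 : ℕ) : ℂ) + 1) • generic N ^ (j + 1) =
            generic N * (completePoly N (m - j) • ((j : ℂ) + 1) • generic N ^ j) +
              generic N * (completePoly N (m + 1 - 1 - j) • generic N ^ j) := by
          intro j _
          rw [Nat.add_sub_add_right, Nat.add_sub_cancel, pow_succ', ← mul_add, ← smul_add,
            mul_smul_comm]
          congr 1
          push_cast
          rw [add_smul _ (1 : ℂ), one_smul, mul_add, mul_smul_comm]
        have h3 := newtonSeq_succ (fun k => (generic N ^ k).trace) m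
        have h4 := grad_newton (N := N) m
        rw [ih (m + 1) (by omega), Finset.sum_add_distrib] at h4
        rw [Finset.sum_congr rfl h1, Finset.sum_congr rfl h2, Finset.sum_add_distrib,
          Finset.sum_add_distrib, ← Finset.sum_smul, ← Finset.mul_sum, ← Finset.mul_sum,
          ← Finset.mul_sum]
        change _ = ∑ j ∈ Finset.range (m + 1), _ * completePoly N (m - j) at h3
        rw [← h3]
        have h7 : newtonSeq (fun k => (generic N ^ k).trace) (m + 1) = completePoly N (m + 1) :=
          rfl
        rw [h7]
        have h5 : ∑ j ∈ Finset.range (m + 1), completePoly N (m + 1 - 1 - j) • generic N ^ j =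
          gradSum N (m + 1) := rfl
        rw [h5]
        have h6 := congrArg (fun M => generic N * M) h4
        simp only [mul_add] at h6
        rw [mul_smul_comm] at h6
        rw [smul_assoc]
        simp only [Nat.sub_zero, Nat.cast_zero, zero_add, one_smul, pow_zero]
        generalize generic N * gradSum N (m + 1) = G at h6 ⊢
        generalize completePoly N (m + 1) • (1 : Matrix (Fin N) (Fin N) (TwistRing N)) = U
        -- The extra `G + U` raises the coefficient from `m + 1` to `m + 2`.
        have h8 : ∀ S T : Matrix (Fin N) (Fin N) (TwistRing N), ((m : ℂ) + 1) • G = S + T →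
            ((m : ℂ) + 1) • U + S + (T + G + U) = (((m + 1 : ℕ) : ℂ) + 1) • (U + G) := by
          intro S T hST
          rw [show ((m : ℂ) + 1) • U + S + (T + G + U) = ((m : ℂ) + 1) • U + (S + T) + (G + U) by
            abel, ← hST]
          push_cast
          module
        exact h8 _ _ h6

/-- `c` is a sequence of invariant polynomials with `∂ c_{m+1} = c_m + ε H ∂ c_m`. -/
structure IsTwisted (ε : ℂ) (c : ℕ → TwistRing N) : Prop where
  grad_zero : grad (c 0) = 0
  grad_succ : ∀ m, grad (c (m + 1)) = c m • 1 + ε • (generic N * grad (c m))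

theorem isTwisted_completePoly : IsTwisted 1 (completePoly N) where
  grad_zero := by rw [completePoly, newtonSeq_zero, grad_one]
  grad_succ m := by
    rw [grad_completePoly_eq_gradSum, gradSum_succ, grad_completePoly_eq_gradSum, one_smul]

theorem IsTwisted.commute_generic {ε : ℂ} {c : ℕ → TwistRing N} (hc : IsTwisted ε c) (m : ℕ) :
    Commute (generic N) (grad (c m)) := by
  induction m with
  | zero => rw [hc.grad_zero]; exact Commute.zero_right _
  | succ m ih =>
    rw [hc.grad_succ]
    exact ((Commute.one_right _).smul_right _).add_right
      (((Commute.refl _).mul_right ih).smul_right ε)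

theorem hookPoly_add (l k : ℕ) : hookPoly N l (k + 1) + hookPoly N (l + 1) k =
    completePoly N (l + 1) * elemPoly N (k + 1) := hookSeq_add _ _ _

theorem hookPoly_zero_right (l : ℕ) : hookPoly N l 0 = completePoly N (l + 1) :=
  hookSeq_zero_right _ _

theorem hookPoly_zero_left (k : ℕ) : hookPoly N 0 k = elemPoly N (k + 1) :=
  hookSeq_zero_left _ _

/-- Auxiliary sequence `b_0 = 0`, `b_{k+1} = e_k - H b_k`. -/
def gradElem (N : ℕ) : ℕ → Matrix (Fin N) (Fin N) (TwistRing N)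
  | 0 => 0
  | k + 1 => elemPoly N k • 1 - generic N * gradElem N k

/-- Induction on `k` by the Pieri relation `hookPoly_add`. The formula is conditional on the
elementary gradients up to `k` because its case `l = 0`, where the hook is `e_{k+1}` and `∂h_1 = 1`,
is what supplies the next one in `grad_elemPoly`. -/
theorem grad_hookPoly_of_forall_le (k : ℕ)
    (hk : ∀ j, j ≤ k → grad (elemPoly N j) = gradElem N j) (l : ℕ) :
    grad (hookPoly N l k) = grad (completePoly N (l + 1)) * gradElem N (k + 1) := by
  have he0 : elemPoly N 0 = 1 := elemSeq_zero _
  induction k generalizing l with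
  | zero =>
    rw [hookPoly_zero_right, gradElem, gradElem, he0, mul_zero, sub_zero, one_smul, mul_one]
  | succ k ih =>
    have h := congrArg grad (hookPoly_add (N := N) l k)
    rw [map_add, ih (fun j hj => hk j (by omega)), grad_mul, hk (k + 1) le_rfl] at h
    have hg : gradElem N (k + 1 + 1) =
      elemPoly N (k + 1) • 1 - generic N * gradElem N (k + 1) := rfl
    rw [eq_sub_of_add_eq h, hg, mul_sub, mul_smul_comm, mul_one,
      isTwisted_completePoly.grad_succ (l + 1), one_smul, add_mul, smul_mul_assoc, one_mul,
      (isTwisted_completePoly.commute_generic (l + 1)).eq, mul_assoc]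
    abel

theorem grad_elemPoly (k : ℕ) : grad (elemPoly N k) = gradElem N k := by
  induction k using Nat.strong_induction_on with
  | _ k ih =>
    cases k with
    | zero => rw [elemPoly, elemSeq_zero, grad_one, gradElem]
    | succ k =>
      rw [← hookPoly_zero_left, grad_hookPoly_of_forall_le k (fun j hj => ih j (by omega)),
        isTwisted_completePoly.grad_succ, isTwisted_completePoly.grad_zero, completePoly,
        newtonSeq_zero]
      simp

theorem isTwisted_elemPoly : IsTwisted (-1) (elemPoly N) where
  grad_zero := by rw [elemPoly, elemSeq_zero, grad_one]
  grad_succ k := by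
    rw [grad_elemPoly, grad_elemPoly, gradElem, neg_one_smul, sub_eq_add_neg]

theorem grad_hookPoly (l k : ℕ) : grad (hookPoly N l k) =
    grad (completePoly N (l + 1)) * grad (elemPoly N (k + 1)) := by
  rw [grad_elemPoly]
  exact grad_hookPoly_of_forall_le k (fun j _ => grad_elemPoly j) l

theorem commute_grad_hook (l k : ℕ) :
    Commute (grad (completePoly N l)) (grad (elemPoly N k)) := by
  induction k with
  | zero => rw [isTwisted_elemPoly.grad_zero]; exact Commute.zero_right _
  | succ k ih =>
    rw [isTwisted_elemPoly.grad_succ]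
    exact ((Commute.one_right _).smul_right _).add_right
      (((isTwisted_completePoly.commute_generic l).symm.mul_right ih).smul_right _)

end GradientRecursions

/-! ### Resolvent sequences and their matrix derivatives -/

section ShiftedSequences

variable {N n : ℕ}

/-- The solution of `t_0 = 0`, `t_{m+1} = s_m + ε h t_m`. -/
def shiftSeq (ε : ℂ) (h : PolyOp N n) (s : ℕ → PolyOp N n) : ℕ → PolyOp N n
  | 0 => 0
  | m + 1 => s m + ε • (h * shiftSeq ε h s m)

/-- On generating functions `shiftSeq ε h` is multiplication by `R(h) = z / (1 - ε z h)`, and this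
is the resolvent identity `R(h') - R(h) = ε (h' - h) R(h) R(h')`. -/
theorem shiftSeq_sub (ε : ℂ) {h h' : PolyOp N n} (hh : Commute h h') (s : ℕ → PolyOp N n)
    (m : ℕ) : shiftSeq ε h' s m - shiftSeq ε h s m =
      ε • ((h' - h) * shiftSeq ε h (shiftSeq ε h' s) m) := by
  induction m with
  | zero => simp [shiftSeq]
  | succ m ih =>
    simp only [shiftSeq]
    have h1 : shiftSeq ε h' s m = shiftSeq ε h s m +
        ε • ((h' - h) * shiftSeq ε h (shiftSeq ε h' s) m) := by rw [← ih]; abel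
    have h2 : (h' - h) * (h * shiftSeq ε h (shiftSeq ε h' s) m) =
        h * ((h' - h) * shiftSeq ε h (shiftSeq ε h' s) m) := by
      rw [← mul_assoc, ← mul_assoc, (hh.sub_right (Commute.refl h)).eq]
    rw [mul_add, mul_smul_comm ε (h' - h), h2,
      ← mul_smul_comm ε h ((h' - h) * _), ← ih]
    simp only [mul_sub, sub_mul, smul_add, smul_sub]
    abel

theorem shiftSeq_comm (ε : ℂ) {h h' : PolyOp N n} (hh : Commute h h') (s : ℕ → PolyOp N n)
    (m : ℕ) : shiftSeq ε h (shiftSeq ε h' s) m = shiftSeq ε h' (shiftSeq ε h s) m := by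
  induction m with
  | zero => simp [shiftSeq]
  | succ m ih =>
    have h1 := shiftSeq_sub ε hh s m
    simp only [shiftSeq]
    rw [eq_add_of_sub_eq h1, ← ih]
    simp only [sub_mul, smul_sub]
    abel

theorem commute_shiftSeq (ε : ℂ) {x h : PolyOp N n} (hx : Commute x h) {s : ℕ → PolyOp N n}
    (hs : ∀ m, Commute x (s m)) (m : ℕ) : Commute x (shiftSeq ε h s m) := by
  induction m with
  | zero => exact Commute.zero_right _
  | succ m ih => exact (hs m).add_right ((hx.mul_right ih).smul_right ε)

theorem mul_shiftSeq (ε : ℂ) {x h h' : PolyOp N n} (hx : x * h = h' * x) {s s' : ℕ → PolyOp N n}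
    (hs : ∀ m, x * s m = s' m * x) (m : ℕ) :
    x * shiftSeq ε h s m = shiftSeq ε h' s' m * x := by
  induction m with
  | zero => simp [shiftSeq]
  | succ m ih =>
    simp only [shiftSeq]
    rw [mul_add, add_mul, hs, mul_smul_comm, ← mul_assoc, hx, mul_assoc, ih, smul_mul_assoc,
      mul_assoc]

/-- The sequence obtained from `c_m` by multiplying its generating function by
`∏_{i ∈ C} z / (1 - ε z h_i)`. -/
def resolventSeq (ε : ℂ) (c : ℕ → TwistRing N) : List (Fin n) → ℕ → PolyOp N n
  | [] => fun m => c m • 1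
  | i :: C => shiftSeq ε (site i (generic N)) (resolventSeq ε c C)

theorem site_generic_commute (i j : Fin n) :
    Commute (site i (generic N)) (site j (generic N)) := by
  by_cases hij : i = j
  · subst hij; exact Commute.refl _
  · exact site_commute hij _ _

theorem commute_resolventSeq (ε : ℂ) (c : ℕ → TwistRing N) {x : PolyOp N n} (C : List (Fin n))
    (hx : ∀ i ∈ C, Commute x (site i (generic N))) (m : ℕ) :
    Commute x (resolventSeq ε c C m) := by
  induction C generalizing m with
  | nil => exact (Commute.one_right x).smul_right _
  | cons i C ih =>
    exact commute_shiftSeq ε (hx i List.mem_cons_self)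
      (fun m => ih (fun j hj => hx j (List.mem_cons_of_mem i hj)) m) m

theorem resolventSeq_commute (ε ε' : ℂ) (c c' : ℕ → TwistRing N) (C C' : List (Fin n))
    (m m' : ℕ) : Commute (resolventSeq ε c C m) (resolventSeq ε' c' C' m') :=
  commute_resolventSeq ε' c' C' (fun _ _ => (commute_resolventSeq ε c C
    (fun _ _ => site_generic_commute _ _) m).symm) m'

theorem resolventSeq_swap (ε : ℂ) (c : ℕ → TwistRing N) (i j : Fin n) (C : List (Fin n))
    (m : ℕ) : resolventSeq ε c (i :: j :: C) m = resolventSeq ε c (j :: i :: C) m :=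
  shiftSeq_comm ε (site_generic_commute i j) _ m

theorem resolventSeq_succ (ε : ℂ) (c : ℕ → TwistRing N) (i : Fin n) (C : List (Fin n)) (m : ℕ) :
    resolventSeq ε c (i :: C) (m + 1) =
      resolventSeq ε c C m + ε • (site i (generic N) * resolventSeq ε c (i :: C) m) := rfl

theorem siteSwap_commute_resolventSeq (ε : ℂ) (c : ℕ → TwistRing N) (i j : Fin n) (m : ℕ) :
    Commute (siteSwap i j) (resolventSeq ε c [i, j] m) := by
  have h0 : ∀ m, siteSwap i j * resolventSeq ε c [] m =
      resolventSeq ε c [] m * (siteSwap i j : PolyOp N n) := fun m => by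
    simp [resolventSeq]
  have h1 : (siteSwap i j : PolyOp N n) * site j (generic N) =
      site i (generic N) * siteSwap i j := by
    rw [siteSwap_comm, siteSwap_mul_site]
  have h2 := mul_shiftSeq ε (siteSwap_mul_site i j (generic N)) (mul_shiftSeq ε h1 h0) m
  exact h2.trans (congrArg (· * siteSwap i j) (resolventSeq_swap ε c j i [] m))

/-- The factor `1 + ε ∑_{j ∈ C} P_{ij}`. -/
def symFactor (ε : ℂ) (i : Fin n) (C : List (Fin n)) : PolyOp N n :=
  1 + ε • (C.map fun j => (siteSwap i j : PolyOp N n)).sum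

theorem symFactor_cons (ε : ℂ) (i j : Fin n) (C : List (Fin n)) :
    (symFactor ε i (j :: C) : PolyOp N n) = symFactor ε i C + ε • siteSwap i j := by
  simp only [symFactor, List.map_cons, List.sum_cons, smul_add]
  abel

theorem symFactor_nil (ε : ℂ) (i : Fin n) : (symFactor ε i [] : PolyOp N n) = 1 := by
  simp [symFactor]

theorem commute_symFactor (ε : ℂ) (i : Fin n) (C : List (Fin n)) {x : PolyOp N n}
    (hx : ∀ j ∈ C, Commute x (siteSwap i j)) : Commute x (symFactor ε i C) := by
  induction C with
  | nil => rw [symFactor_nil]; exact Commute.one_right x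
  | cons j C ih =>
    rw [symFactor_cons]
    exact (ih fun k hk => hx k (List.mem_cons_of_mem j hk)).add_right
      ((hx j List.mem_cons_self).smul_right ε)

variable {ε : ℂ} {c : ℕ → TwistRing N}

theorem polyDeriv_smul_one_eq (hc : IsTwisted ε c) (i : Fin n) (m : ℕ) :
    polyDeriv i (c m • (1 : PolyOp N n)) = resolventSeq ε c [i] m := by
  rw [polyDeriv_smul_one]
  induction m with
  | zero => rw [hc.grad_zero, site_zero]; rfl
  | succ m ih =>
    have h : ∀ M : Matrix (Fin N) (Fin N) (TwistRing N), site i (ε • M) = ε • site i M := by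
      intro M
      ext1 u v
      simp only [site_apply, Matrix.smul_apply]
      split_ifs <;> simp
    rw [hc.grad_succ, site_add, site_smul, site_one, h, site_mul, ih, resolventSeq_succ]
    rfl

/-- The derivative at `i` either hits `c`, which creates a resolvent at `i`, or hits the resolvent
of some `j ∈ C`, which creates a resolvent at `i` and an exchange `P_{ij}`. -/
theorem polyDeriv_resolventSeq (hc : IsTwisted ε c) {i : Fin n} {C : List (Fin n)}
    (hi : i ∉ C) (hC : C.Nodup) (m : ℕ) :
    polyDeriv i (resolventSeq ε c C m) = symFactor ε i C * resolventSeq ε c (i :: C) m := by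
  induction C generalizing m with
  | nil => rw [symFactor_nil, one_mul]; exact polyDeriv_smul_one_eq hc i m
  | cons j C ih =>
    have hij : i ≠ j := fun h => hi (h ▸ List.mem_cons_self)
    have hiC : i ∉ C := fun h => hi (List.mem_cons_of_mem j h)
    obtain ⟨hjC, hC'⟩ := List.nodup_cons.mp hC
    induction m with
    | zero => simp [resolventSeq, shiftSeq]
    | succ m ihm =>
      have h1 : Commute (site j (generic N)) (symFactor ε i C : PolyOp N n) :=
        commute_symFactor ε i C fun k hk =>
          (siteSwap_commute_site hij.symm (fun h => hjC (h ▸ hk)) _).symm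
      have h2 : (siteSwap i j : PolyOp N n) * site i (generic N) =
          site j (generic N) * siteSwap i j := siteSwap_mul_site i j _
      -- The index `m + 1` can be lowered by peeling off either the resolvent at `i` or the one at
      -- `j`. The first form goes with the summand `P_{ij}`, which turns `H` at `i` into `H` at `j`;
      -- the second goes with the rest of the symmetric factor, which commutes with `H` at `j`.
      have e1 := resolventSeq_succ ε c i (j :: C) m
      have e2 : resolventSeq ε c (i :: j :: C) (m + 1) = resolventSeq ε c (i :: C) m +
          ε • (site j (generic N) * resolventSeq ε c (i :: j :: C) m) := by
        rw [resolventSeq_swap, resolventSeq_succ, resolventSeq_swap]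
      have t1 : symFactor ε i C * resolventSeq ε c (i :: j :: C) (m + 1) =
          symFactor ε i C * resolventSeq ε c (i :: C) m + ε • (site j (generic N) *
            (symFactor ε i C * resolventSeq ε c (i :: j :: C) m)) := by
        rw [e2, mul_add, mul_smul_comm, ← mul_assoc, ← h1.eq, mul_assoc]
      have t2 : siteSwap i j * resolventSeq ε c (i :: j :: C) (m + 1) =
          siteSwap i j * resolventSeq ε c (j :: C) m + ε • (site j (generic N) *
            (siteSwap i j * resolventSeq ε c (i :: j :: C) m)) := by
        rw [e1, mul_add, mul_smul_comm, ← mul_assoc, h2, mul_assoc]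
      rw [resolventSeq_succ, map_add, map_smul, ih hiC hC', polyDeriv_mul i (.site hij _),
        polyDeriv_site_generic hij, ihm, symFactor_cons, add_mul _ _ (resolventSeq _ _ _ (m + 1)),
        smul_mul_assoc, t1, t2]
      simp only [add_mul, mul_add, smul_add, smul_mul_assoc, mul_smul_comm]
      abel

/-! ### Iterated derivatives: (anti)symmetry, commutation and vanishing products -/

/-- The composition of the matrix derivatives along a list of sites. -/
def iterDeriv : List (Fin n) → PolyOp N n →ₗ[ℂ] PolyOp N n
  | [] => LinearMap.id
  | i :: C => polyDeriv i ∘ₗ iterDeriv C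

theorem iterDeriv_nil (F : PolyOp N n) : iterDeriv [] F = F := rfl

theorem iterDeriv_cons (i : Fin n) (C : List (Fin n)) (F : PolyOp N n) :
    iterDeriv (i :: C) F = polyDeriv i (iterDeriv C F) := rfl

theorem polyDeriv_iterDeriv {i : Fin n} {C : List (Fin n)} (hi : i ∉ C) (F : PolyOp N n) :
    polyDeriv i (iterDeriv C F) = iterDeriv C (polyDeriv i F) := by
  induction C with
  | nil => rfl
  | cons j C ih =>
    rw [iterDeriv_cons, polyDeriv_comm (List.ne_of_not_mem_cons hi),
      ih fun h => hi (List.mem_cons_of_mem j h), iterDeriv_cons]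

theorem iterDeriv_erase {i : Fin n} {C : List (Fin n)} (hi : i ∈ C) (hC : C.Nodup)
    (F : PolyOp N n) : iterDeriv C F = iterDeriv (C.erase i) (polyDeriv i F) := by
  induction C with
  | nil => simp at hi
  | cons j C ih =>
    obtain ⟨hj, hC'⟩ := List.nodup_cons.mp hC
    by_cases hij : j = i
    · subst hij
      rw [List.erase_cons_head, iterDeriv_cons, polyDeriv_iterDeriv hj]
    · rw [List.erase_cons_tail (by simpa using hij), iterDeriv_cons, iterDeriv_cons,
        ih ((List.mem_cons.mp hi).resolve_left (Ne.symm hij)) hC']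

/-- The operator `F` does not depend on the twist matrix. -/
def IsConstOp (F : PolyOp N n) : Prop := ∀ b a : Fin N, entryDeriv b a F = 0

theorem IsConstOp.polyDeriv_eq_zero {F : PolyOp N n} (hF : IsConstOp F) (i : Fin n) :
    polyDeriv i F = 0 := by
  rw [polyDeriv_apply]
  exact Finset.sum_eq_zero fun a _ => Finset.sum_eq_zero fun b _ => by rw [hF, mul_zero]

theorem IsConstOp.mul {F G : PolyOp N n} (hF : IsConstOp F) (hG : IsConstOp G) :
    IsConstOp (F * G) := fun b a => by
  rw [entryDeriv_mul, hF, hG, zero_mul, mul_zero, add_zero]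

theorem isConstOp_one : IsConstOp (1 : PolyOp N n) := fun b a => entryDeriv_one b a

theorem isConstOp_symFactor (ε : ℂ) (i : Fin n) (C : List (Fin n)) :
    IsConstOp (symFactor ε i C : PolyOp N n) := fun b a => by
  induction C with
  | nil => rw [symFactor_nil]; exact entryDeriv_one b a
  | cons j C ih => rw [symFactor_cons, map_add, ih, map_smul, entryDeriv_siteSwap, smul_zero,
      add_zero]

theorem TrivialAt.symFactor (ε : ℂ) {k i : Fin n} {C : List (Fin n)} (hki : k ≠ i)
    (hk : k ∉ C) : TrivialAt k (symFactor ε i C : PolyOp N n) := fun a b =>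
  commute_symFactor ε i C fun j hj =>
    TrivialAt.siteSwap hki (fun h : k = j => hk (h ▸ hj)) a b

/-- The (anti)symmetrizer of the sites in `C`, for `ε = 1` (`ε = -1`). -/
def symProd (ε : ℂ) : List (Fin n) → PolyOp N n
  | [] => 1
  | i :: C => symProd ε C * symFactor ε i C

theorem isConstOp_symProd (ε : ℂ) (C : List (Fin n)) : IsConstOp (symProd ε C : PolyOp N n) := by
  induction C with
  | nil => exact isConstOp_one
  | cons i C ih => exact ih.mul (isConstOp_symFactor ε i C)

theorem TrivialAt.symProd (ε : ℂ) {k : Fin n} {C : List (Fin n)} (hk : k ∉ C) :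
    TrivialAt k (symProd ε C : PolyOp N n) := by
  induction C with
  | nil => exact TrivialAt.one k
  | cons i C ih =>
    have hkC : k ∉ C := fun h => hk (List.mem_cons_of_mem i h)
    exact (ih hkC).mul (TrivialAt.symFactor ε (fun h => hk (h ▸ List.mem_cons_self)) hkC)

theorem iterDeriv_smul_one (hc : IsTwisted ε c) {C : List (Fin n)} (hC : C.Nodup) (m : ℕ) :
    iterDeriv C (c m • (1 : PolyOp N n)) = symProd ε C * resolventSeq ε c C m := by
  induction C with
  | nil => rw [iterDeriv_nil, symProd, one_mul]; rfl
  | cons i C ih =>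
    obtain ⟨hi, hC'⟩ := List.nodup_cons.mp hC
    rw [iterDeriv_cons, ih hC', polyDeriv_mul i (.symProd ε hi),
      (isConstOp_symProd ε C).polyDeriv_eq_zero, zero_mul, zero_add,
      polyDeriv_resolventSeq hc hi hC', symProd, mul_assoc]

theorem iterDeriv_const_mul {C : List (Fin n)} {P : PolyOp N n} (hP : IsConstOp P)
    (hPC : ∀ i ∈ C, TrivialAt i P) (F : PolyOp N n) :
    iterDeriv C (P * F) = P * iterDeriv C F := by
  induction C with
  | nil => rfl
  | cons i C ih =>
    rw [iterDeriv_cons, ih fun j hj => hPC j (List.mem_cons_of_mem i hj),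
      polyDeriv_mul i (hPC i List.mem_cons_self), hP.polyDeriv_eq_zero, zero_mul, zero_add,
      iterDeriv_cons]

theorem polyDeriv_mul_const {P : PolyOp N n} (hP : IsConstOp P) (i : Fin n) (F : PolyOp N n) :
    polyDeriv i (F * P) = polyDeriv i F * P := by
  simp only [polyDeriv_apply, Finset.sum_mul, entryDeriv_mul, hP _ _, mul_zero, add_zero,
    mul_assoc]

theorem iterDeriv_mul_const {P : PolyOp N n} (hP : IsConstOp P) (C : List (Fin n))
    (F : PolyOp N n) : iterDeriv C (F * P) = iterDeriv C F * P := by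
  induction C with
  | nil => rfl
  | cons i C ih => rw [iterDeriv_cons, ih, polyDeriv_mul_const hP, iterDeriv_cons]

theorem isConstOp_siteSwap (i j : Fin n) : IsConstOp (siteSwap i j : PolyOp N n) :=
  fun b a => entryDeriv_siteSwap b a i j

/-- `∂_i ∂_j c_m` is (anti)symmetric under the exchange of the sites `i` and `j`. -/
theorem siteSwap_mul_polyDeriv_polyDeriv (hε : ε * ε = 1) (hc : IsTwisted ε c) {i j : Fin n}
    (hij : i ≠ j) (m : ℕ) :
    siteSwap i j * polyDeriv i (polyDeriv j (c m • (1 : PolyOp N n))) =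
        ε • polyDeriv i (polyDeriv j (c m • 1)) ∧
      polyDeriv i (polyDeriv j (c m • (1 : PolyOp N n))) * siteSwap i j =
        ε • polyDeriv i (polyDeriv j (c m • 1)) := by
  have h := iterDeriv_smul_one hc (C := [i, j]) (by simpa using hij) m
  have h1 : (symProd ε [i, j] : PolyOp N n) = 1 + ε • siteSwap i j := by
    simp [symProd, symFactor]
  have h2 : (siteSwap i j : PolyOp N n) * (1 + ε • siteSwap i j) =
      ε • (1 + ε • siteSwap i j) := by
    rw [mul_add, mul_smul_comm, siteSwap_mul_self, smul_add, smul_smul, hε]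
    simp [add_comm]
  have h3 : (1 + ε • siteSwap i j) * (siteSwap i j : PolyOp N n) =
      ε • (1 + ε • siteSwap i j) := by
    rw [add_mul, smul_mul_assoc, siteSwap_mul_self, smul_add, smul_smul, hε]
    simp [add_comm]
  rw [iterDeriv_cons, iterDeriv_cons, iterDeriv_nil, h1] at h
  rw [h]
  constructor
  · rw [← mul_assoc, h2, smul_mul_assoc]
  · rw [mul_assoc, ← (siteSwap_commute_resolventSeq ε c i j m).eq, ← mul_assoc, h3,
      smul_mul_assoc]

/-- The derivatives commute, so those at `i` and `j` may be applied first. The exchange of `i` and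
`j` is constant and trivial at the other sites, hence passes through the other derivatives, which
leaves the two-site case. -/
theorem siteSwap_mul_iterDeriv (hε : ε * ε = 1) (hc : IsTwisted ε c) {C : List (Fin n)}
    (hC : C.Nodup) {i j : Fin n} (hi : i ∈ C) (hj : j ∈ C) (hij : i ≠ j) (m : ℕ) :
    siteSwap i j * iterDeriv C (c m • (1 : PolyOp N n)) = ε • iterDeriv C (c m • 1) ∧
      iterDeriv C (c m • (1 : PolyOp N n)) * siteSwap i j = ε • iterDeriv C (c m • 1) := by
  obtain ⟨h1, h2⟩ := siteSwap_mul_polyDeriv_polyDeriv hε hc hij m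
  have hCi : (C.erase j).Nodup := hC.erase j
  have hi' : i ∈ C.erase j := (List.mem_erase_of_ne hij).mpr hi
  rw [iterDeriv_erase hj hC, iterDeriv_erase hi' hCi]
  constructor
  · rw [← iterDeriv_const_mul (isConstOp_siteSwap i j), h1, map_smul]
    intro k hk
    have hki := (hCi.mem_erase_iff.mp hk)
    exact TrivialAt.siteSwap hki.1 (hC.mem_erase_iff.mp hki.2).1
  · rw [← iterDeriv_mul_const (isConstOp_siteSwap i j), h2, map_smul]

theorem iterDeriv_mul_symFactor (hε : ε * ε = 1) (hc : IsTwisted ε c) {C : List (Fin n)}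
    (hC : C.Nodup) {i : Fin n} (hi : i ∈ C) {C' : List (Fin n)} (hC' : C' ⊆ C) (hi' : i ∉ C')
    (m : ℕ) : iterDeriv C (c m • (1 : PolyOp N n)) * symFactor ε i C' =
      ((C'.length : ℂ) + 1) • iterDeriv C (c m • 1) := by
  induction C' with
  | nil => rw [symFactor_nil, mul_one]; simp
  | cons j C' ih =>
    have hij : i ≠ j := fun h => hi' (h ▸ List.mem_cons_self)
    rw [symFactor_cons, mul_add, ih (fun k hk => hC' (List.mem_cons_of_mem j hk))
      (fun h => hi' (List.mem_cons_of_mem j h)), mul_smul_comm,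
      (siteSwap_mul_iterDeriv hε hc hC hi (hC' List.mem_cons_self) hij m).2, smul_smul, hε,
      List.length_cons]
    push_cast
    rw [add_smul (_ + 1) (1 : ℂ)]

/-- Each factor of the (anti)symmetrizer acts by a scalar. The constant is `|C'|!`, but only its
independence of `m` is needed. -/
theorem exists_iterDeriv_mul_symProd (hε : ε * ε = 1) (hc : IsTwisted ε c) {C : List (Fin n)}
    (hC : C.Nodup) {C' : List (Fin n)} (hC' : C' ⊆ C) (hn : C'.Nodup) :
    ∃ k : ℂ, ∀ m, iterDeriv C (c m • (1 : PolyOp N n)) * symProd ε C' =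
      k • iterDeriv C (c m • 1) := by
  induction C' with
  | nil => exact ⟨1, fun m => by rw [symProd, mul_one, one_smul]⟩
  | cons i C' ih =>
    obtain ⟨hi, hn'⟩ := List.nodup_cons.mp hn
    have hsub : C' ⊆ C := fun j hj => hC' (List.mem_cons_of_mem i hj)
    obtain ⟨k, hk⟩ := ih hsub hn'
    refine ⟨k * ((C'.length : ℂ) + 1), fun m => ?_⟩
    rw [symProd, ← mul_assoc, hk, smul_mul_assoc,
      iterDeriv_mul_symFactor hε hc hC (hC' List.mem_cons_self) hsub hi, smul_smul]

/-- The left factor absorbs the (anti)symmetrizer of the right one. What remains is one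
(anti)symmetrizer times a product of two resolvent sequences, and these commute. -/
theorem iterDeriv_commute (hε : ε * ε = 1) (hc : IsTwisted ε c) {C : List (Fin n)}
    (hC : C.Nodup) (m m' : ℕ) :
    Commute (iterDeriv C (c m • (1 : PolyOp N n))) (iterDeriv C (c m' • 1)) := by
  obtain ⟨k, hk⟩ := exists_iterDeriv_mul_symProd (n := n) hε hc hC (List.Subset.refl C) hC
  have key : ∀ m m', iterDeriv C (c m • (1 : PolyOp N n)) * iterDeriv C (c m' • 1) =
      k • (symProd ε C * (resolventSeq ε c C m * resolventSeq ε c C m')) := by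
    intro m m'
    rw [iterDeriv_smul_one hc hC m', ← mul_assoc, hk, smul_mul_assoc, iterDeriv_smul_one hc hC m,
      mul_assoc]
  rw [Commute, SemiconjBy, key, key, (resolventSeq_commute ε ε c c C C m m').eq]

theorem eq_zero_of_eq_neg_self {X : PolyOp N n} (h : X = -X) : X = 0 := by
  have h2 : (2 : ℂ) • X = 0 := by
    rw [two_smul]
    nth_rw 2 [h]
    exact add_neg_cancel X
  have h3 := congrArg (fun Y => (2 : ℂ)⁻¹ • Y) h2
  simpa [smul_smul] using h3

/-- With the exchange `P_{ij}` inserted between the two factors, the symmetric one absorbs it with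
sign `+` and the antisymmetric one with sign `-`. -/
theorem iterDeriv_mul_iterDeriv_eq_zero {c' : ℕ → TwistRing N} (hc : IsTwisted 1 c)
    (hc' : IsTwisted (-1) c') {C : List (Fin n)} (hC : C.Nodup) {i j : Fin n} (hi : i ∈ C)
    (hj : j ∈ C) (hij : i ≠ j) (m m' : ℕ) :
    iterDeriv C (c m • (1 : PolyOp N n)) * iterDeriv C (c' m' • 1) = 0 ∧
      iterDeriv C (c' m' • (1 : PolyOp N n)) * iterDeriv C (c m • 1) = 0 := by
  obtain ⟨h1, h2⟩ := siteSwap_mul_iterDeriv (by ring) hc hC hi hj hij m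
  obtain ⟨h3, h4⟩ := siteSwap_mul_iterDeriv (by ring) hc' hC hi hj hij m'
  rw [one_smul] at h1 h2
  rw [neg_one_smul] at h3 h4
  constructor
  · have := mul_assoc (iterDeriv C (c m • (1 : PolyOp N n))) (siteSwap i j)
      (iterDeriv C (c' m' • 1))
    rw [h2, h3, mul_neg] at this
    exact eq_zero_of_eq_neg_self this
  · have := mul_assoc (iterDeriv C (c' m' • (1 : PolyOp N n))) (siteSwap i j)
      (iterDeriv C (c m • 1))
    rw [h4, h1, neg_mul] at this
    exact eq_zero_of_eq_neg_self this.symm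

end ShiftedSequences

/-! ### Determinants of rank-one perturbations with commuting entries -/

section AffineDeterminants

open Polynomial

theorem opDet_map {S S' : Type*} [Ring S] [Ring S'] (f : S →+* S') {d : ℕ}
    (A : Matrix (Fin d) (Fin d) S) : f (opDet A) = opDet (A.map f) := by
  simp only [opDet, map_sum, map_zsmul, map_list_prod, List.map_ofFn]
  rfl

theorem opDet_eq_det {S : Type*} [CommRing S] {d : ℕ} (A : Matrix (Fin d) (Fin d) S) :
    opDet A = A.det := by
  simp only [opDet, Matrix.det_apply, List.prod_ofFn, Units.smul_def]

variable {S : Type*} [Ring S]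

theorem natDegree_C_add_X_mul_C_le (x y : S) : (C x + X * C y).natDegree ≤ 1 := by
  refine (natDegree_add_le _ _).trans (max_le (by simp) ?_)
  exact (natDegree_mul_le).trans (by simpa using natDegree_X_le)

/-- If the matrices `Φ + X E` have commuting entries, `E_{pq} = E_{po} E_{oq}` and `E_{oo} = 1`,
then their determinants are affine in `X`. -/
theorem natDegree_opDet_le_one [Nontrivial S] {ι : Type*} (Φ E : ι → ι → S) (o : ι)
    (hcomm : ∀ p q p' q', Commute (C (Φ p q) + X * C (E p q)) (C (Φ p' q') + X * C (E p' q')))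
    (hE : ∀ p q, E p q = E p o * E o q) (ho : E o o = 1) {d : ℕ} (r s : Fin d → ι) :
    (opDet (Matrix.of fun i j => C (Φ (r i) (s j)) + X * C (E (r i) (s j)))).natDegree ≤ 1 := by
  set a : ι → ι → S[X] := fun p q => C (Φ p q) + X * C (E p q) with ha
  let T : Set S[X] := Set.range fun p : ι × ι => a p.1 p.2
  have hT : ∀ x ∈ T, ∀ y ∈ T, x * y = y * x := by
    rintro _ ⟨p, rfl⟩ _ ⟨q, rfl⟩
    exact hcomm _ _ _ _
  -- The ring `S[X]` need not be commutative, but the commuting entries generate a commutative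
  -- subring in which the usual theory of determinants applies.
  let B := Algebra.adjoin ℤ T
  let inst : CommRing B :=
    { B.toRing with
      mul_comm := fun x y => (Algebra.isMulCommutative_adjoin ℤ hT).is_comm.comm x y }
  let b : ι → ι → B := fun p q => ⟨a p q, Algebra.subset_adjoin ⟨(p, q), rfl⟩⟩
  let φ : B →+* S[X] := B.val.toRingHom
  have hφb : ∀ p q, φ (b p q) = a p q := fun _ _ => rfl
  have hprod : ∀ {κ : Type} (t : Finset κ) (f : κ → B), (∀ i ∈ t, (φ (f i)).natDegree ≤ 1) →
      (φ (∏ i ∈ t, f i)).natDegree ≤ t.card := by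
    classical
    intro κ t f
    induction t using Finset.induction_on with
    | empty => intro _; simp
    | insert i t hi ih =>
      intro h
      rw [Finset.prod_insert hi, map_mul, Finset.card_insert_of_notMem hi, add_comm]
      exact natDegree_mul_le_of_le (h i (Finset.mem_insert_self i t))
        (ih fun j hj => h j (Finset.mem_insert_of_mem hj))
  have hdet : ∀ {κ : Type} [Fintype κ] [DecidableEq κ] (M : Matrix κ κ B),
      (∀ i j, (φ (M i j)).natDegree ≤ 1) → (φ M.det).natDegree ≤ Fintype.card κ := by
    intro κ _ _ M hM
    rw [Matrix.det_apply, map_sum]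
    refine natDegree_sum_le_of_forall_le _ _ fun σ _ => ?_
    have h1 := hprod Finset.univ (fun i => M (σ i) i) fun i _ => hM _ _
    rw [Units.smul_def, map_zsmul]
    rcases Int.units_eq_one_or (Equiv.Perm.sign σ) with h | h <;> rw [h]
    · simpa using h1
    · simpa using h1
  have hadeg : ∀ p q, (a p q).natDegree ≤ 1 := fun _ _ => natDegree_C_add_X_mul_C_le _ _
  -- The coefficient of `X^2` in this minor is `E_{oo} E_{pq} - E_{po} E_{oq} = 0`.
  have hmin : ∀ p q, (φ (b o o * b p q - b p o * b o q)).natDegree ≤ 1 := by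
    intro p q
    have : φ (b o o * b p q - b p o * b o q) =
        C (Φ o o * Φ p q - Φ p o * Φ o q) +
          X * C (Φ o o * E p q + E o o * Φ p q - Φ p o * E o q - E p o * Φ o q) := by
      rw [map_sub, map_mul, map_mul, hφb, hφb, hφb, hφb]
      simp only [ha]
      have h2 : C (E o o) * C (E p q) = C (E p o) * C (E o q) := by
        rw [← C_mul, ← C_mul, ho, one_mul, hE p q]
      have h3 : X * C (E o o) * (X * C (E p q)) = X * C (E p o) * (X * C (E o q)) := by
        rw [mul_assoc, ← mul_assoc (C _) X, ← X_mul_C, mul_assoc X, h2, mul_assoc X (C (E p o)),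
          ← mul_assoc (C (E p o)) X, ← X_mul_C, mul_assoc X (C (E p o))]
      have h4 : ∀ x y : S, C x * (X * C y) = X * C (x * y) := fun x y => by
        rw [← mul_assoc, ← X_mul_C, mul_assoc, ← C_mul]
      have h5 : ∀ x y : S, X * C x * C y = X * C (x * y) := fun x y => by
        rw [mul_assoc, ← C_mul]
      simp only [add_mul, mul_add, h3, h4, h5, C_add, C_sub, C_mul, mul_sub]
      abel
    rw [this]
    exact natDegree_C_add_X_mul_C_le _ _
  let M : Matrix (Fin d) (Fin d) B := Matrix.of fun i j => b (r i) (s j)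
  have hM : opDet (Matrix.of fun i j => a (r i) (s j)) = φ M.det := by
    rw [← opDet_eq_det, opDet_map]
    rfl
  -- By the Schur complement, `b_{oo}^d det M` is a determinant of size `d + 1` whose border
  -- consists of entries of `b` and whose main block consists of the minors above; every entry is
  -- affine in `X`.
  have hdegM : (φ (b o o ^ d * M.det)).natDegree ≤ d + 1 := by
    let col : Matrix (Fin d) Unit B := Matrix.of fun i _ => b (r i) o
    let row : Matrix Unit (Fin d) B := Matrix.of fun _ j => -b o (s j)
    let D : Matrix (Fin d) (Fin d) B := Matrix.of fun i j =>
      b o o * b (r i) (s j) - b (r i) o * b o (s j)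
    have h1 : b o o ^ d * M.det = (Matrix.fromBlocks 1 row col D).det := by
      rw [Matrix.det_fromBlocks_one₁₁]
      have : D - col * row = b o o • M := by
        ext1 i j
        simp [D, col, row, M, Matrix.mul_apply]
      rw [this, Matrix.det_smul, Fintype.card_fin]
    rw [h1]
    refine (hdet _ ?_).trans (by simp [add_comm])
    rintro (i | i) (j | j)
    · simp
    · simpa [row, hφb] using hadeg _ _
    · simpa [col, hφb] using hadeg _ _
    · exact hmin _ _
  -- Being monic of degree one, `a_{oo}` can be removed from the degree count even if `S` has zero
  -- divisors: `d + deg(det M) ≤ d + 1`.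
  have hmonic : (a o o).Monic ∧ (a o o).natDegree = 1 := by
    have : a o o = X + C (Φ o o) := by simp [ha, ho, add_comm]
    rw [this]
    exact ⟨monic_X_add_C _, natDegree_X_add_C _⟩
  change (opDet (Matrix.of fun i j => a (r i) (s j))).natDegree ≤ 1
  rw [hM]
  by_cases h0 : φ M.det = 0
  · rw [h0]; simp
  · rw [map_mul, map_pow, hφb, (hmonic.1.pow d).natDegree_mul' h0, hmonic.1.natDegree_pow,
      hmonic.2] at hdegM
    omega

theorem coeff_list_prod {δ : S →+ S} {P : S → Prop}
    (hmul : ∀ x y, P x → δ (x * y) = δ x * y + x * δ y) (h1 : δ 1 = 0) (l : List S)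
    (hl : ∀ x ∈ l, P x) :
    (l.map fun x => C x + X * C (δ x)).prod.coeff 0 = l.prod ∧
      (l.map fun x => C x + X * C (δ x)).prod.coeff 1 = δ l.prod := by
  induction l with
  | nil => simp [h1, coeff_one]
  | cons x l ih =>
    obtain ⟨ih0, ih1⟩ := ih fun y hy => hl y (List.mem_cons_of_mem x hy)
    rw [List.map_cons, List.prod_cons, List.prod_cons, mul_coeff_zero, mul_coeff_one, ih0, ih1,
      hmul x _ (hl x List.mem_cons_self)]
    simp [coeff_C, add_comm]

/-- A determinant which is affine in the deformation parameter is determined by its value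
and its derivative at zero. -/
theorem opDet_add_smul [Algebra ℂ S] {δ : S →+ S} {P : S → Prop}
    (hmul : ∀ x y, P x → δ (x * y) = δ x * y + x * δ y) (h1 : δ 1 = 0) {d : ℕ}
    (A : Matrix (Fin d) (Fin d) S) (hA : ∀ i j, P (A i j))
    (hdeg : (opDet (Matrix.of fun i j => C (A i j) + X * C (δ (A i j)))).natDegree ≤ 1) (t : ℂ) :
    opDet (Matrix.of fun i j => A i j + t • δ (A i j)) = opDet A + t • δ (opDet A) := by
  set p := opDet (Matrix.of fun i j => C (A i j) + X * C (δ (A i j))) with hp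
  have hcoeff : p.coeff 0 = opDet A ∧ p.coeff 1 = δ (opDet A) := by
    have key : ∀ σ : Equiv.Perm (Fin d), _ := fun σ => coeff_list_prod hmul h1
      (List.ofFn fun j => A (σ j) j) (by
        intro x hx
        obtain ⟨j, rfl⟩ := (List.mem_ofFn' _ _).mp hx
        exact hA _ _)
    simp only [List.map_ofFn] at key
    constructor
    · rw [hp, opDet, finsetSum_coeff, opDet]
      refine Finset.sum_congr rfl fun σ _ => ?_
      rw [coeff_smul, ← (key σ).1]
      rfl
    · rw [hp, opDet, finsetSum_coeff, opDet, map_sum]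
      refine Finset.sum_congr rfl fun σ _ => ?_
      rw [coeff_smul, map_zsmul, ← (key σ).2]
      rfl
  let ev : S[X] →+* S := eval₂RingHom' (RingHom.id S) (algebraMap ℂ S t)
    fun x => (Algebra.commutes t x).symm
  have hev : ∀ x y : S, ev (C x + X * C y) = x + t • y := fun x y => by
    rw [map_add, map_mul, Algebra.smul_def]
    change eval₂ (RingHom.id S) _ (C x) + eval₂ (RingHom.id S) _ X *
      eval₂ (RingHom.id S) _ (C y) = _
    rw [eval₂_C, eval₂_C, eval₂_X]
    rfl
  have h2 : p = C (p.coeff 0) + X * C (p.coeff 1) := by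
    conv_lhs => rw [eq_X_add_C_of_natDegree_le_one hdeg]
    rw [← X_mul_C, add_comm]
  calc _ = ev p := by
        rw [hp, opDet_map]
        congr 1
        ext1 i j
        exact (hev _ _).symm
    _ = _ := by rw [h2, hev, hcoeff.1, hcoeff.2]

end AffineDeterminants

/-! ### Induction over the marked points -/

section GaudinInduction

variable {N n : ℕ}

/-- The operator `∏_{i ∈ L} (1 + a_i ∂_i)`, the head of the list being applied last. -/
def gaudinOp (a : Fin n → ℂ) : List (Fin n) → PolyOp N n →ₗ[ℂ] PolyOp N n
  | [] => LinearMap.id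
  | i :: L => gaudinOp a L + a i • (polyDeriv i ∘ₗ gaudinOp a L)

variable {a : Fin n → ℂ}

theorem gaudinOp_nil (F : PolyOp N n) : gaudinOp a [] F = F := rfl

theorem gaudinOp_cons (i : Fin n) (L : List (Fin n)) (F : PolyOp N n) :
    gaudinOp a (i :: L) F = gaudinOp a L F + a i • polyDeriv i (gaudinOp a L F) := rfl

theorem TrivialAt.gaudinOp {i : Fin n} {L : List (Fin n)} (hi : i ∉ L) {F : PolyOp N n}
    (hF : TrivialAt i F) : TrivialAt i (gaudinOp a L F) := by
  induction L with
  | nil => exact hF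
  | cons j L ih =>
    have h := ih (List.not_mem_of_not_mem_cons hi)
    exact h.add ((h.polyDeriv (List.ne_of_not_mem_cons hi)).smul _)

theorem polyDeriv_gaudinOp {i : Fin n} {L : List (Fin n)} (hi : i ∉ L) (F : PolyOp N n) :
    polyDeriv i (gaudinOp a L F) = gaudinOp a L (polyDeriv i F) := by
  induction L with
  | nil => rfl
  | cons j L ih =>
    rw [gaudinOp_cons, map_add, map_smul, polyDeriv_comm (List.ne_of_not_mem_cons hi),
      ih (List.not_mem_of_not_mem_cons hi), gaudinOp_cons]

theorem gaudinOp_one (L : List (Fin n)) : gaudinOp a L (1 : PolyOp N n) = 1 := by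
  induction L with
  | nil => rfl
  | cons i L ih => rw [gaudinOp_cons, ih, polyDeriv_one, smul_zero, add_zero]

/-- The Leibniz rule collects the two linear terms into the derivative of the product. The quadratic
term is the only defect of multiplicativity. -/
theorem gaudinOp_cons_mul {i : Fin n} {L : List (Fin n)} (hi : i ∉ L) {F : PolyOp N n}
    (hF : TrivialAt i F) (G : PolyOp N n) :
    gaudinOp a (i :: L) F * gaudinOp a (i :: L) G =
      gaudinOp a L F * gaudinOp a L G +
        a i • polyDeriv i (gaudinOp a L F * gaudinOp a L G) +
        (a i * a i) • (gaudinOp a L (polyDeriv i F) * gaudinOp a L (polyDeriv i G)) := by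
  rw [gaudinOp_cons, gaudinOp_cons, polyDeriv_mul i (hF.gaudinOp hi), ← polyDeriv_gaudinOp hi,
    ← polyDeriv_gaudinOp hi]
  simp only [add_mul, mul_add, smul_mul_assoc, mul_smul_comm, smul_smul, smul_add]
  abel

/-- The product formula reduces the claim to fewer sites, for `F`, `G` and for their derivatives at
`i`. The hypothesis runs over all sublists so that it passes to both pairs. -/
theorem gaudinOp_commute {L : List (Fin n)} (hL : L.Nodup) {F G : PolyOp N n}
    (hF : ∀ i ∈ L, TrivialAt i F) (hG : ∀ i ∈ L, TrivialAt i G)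
    (h : ∀ C : List (Fin n), C.Sublist L → Commute (iterDeriv C F) (iterDeriv C G)) :
    Commute (gaudinOp a L F) (gaudinOp a L G) := by
  induction L generalizing F G with
  | nil => exact h [] (List.Sublist.refl _)
  | cons i L ih =>
    obtain ⟨hi, hL'⟩ := List.nodup_cons.mp hL
    have hFL := fun j hj => hF j (List.mem_cons_of_mem i hj)
    have hGL := fun j hj => hG j (List.mem_cons_of_mem i hj)
    have h1 := ih hL' hFL hGL fun C hC => h C (hC.cons i)
    have h2 : Commute (gaudinOp a L (polyDeriv i F)) (gaudinOp a L (polyDeriv i G)) := by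
      refine ih hL' (fun j hj => (hFL j hj).polyDeriv (ne_of_mem_of_not_mem hj hi))
        (fun j hj => (hGL j hj).polyDeriv (ne_of_mem_of_not_mem hj hi)) fun C hC => ?_
      have hiC : i ∉ C := fun h => hi (hC.subset h)
      rw [← polyDeriv_iterDeriv hiC, ← polyDeriv_iterDeriv hiC]
      exact h (i :: C) (hC.cons_cons i)
    rw [Commute, SemiconjBy, gaudinOp_cons_mul hi (hF i List.mem_cons_self),
      gaudinOp_cons_mul hi (hG i List.mem_cons_self), h1.eq, h2.eq]

/-- By induction the quadratic term in `gaudinOp_cons_mul` is `gaudinOp` of the product of the two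
derivatives at `i`, and this product is zero by the case `C = [i]`. -/
theorem gaudinOp_mul {L : List (Fin n)} (hL : L.Nodup) {F G : PolyOp N n}
    (hF : ∀ i ∈ L, TrivialAt i F)
    (h : ∀ C : List (Fin n), C.Sublist L → C ≠ [] → iterDeriv C F * iterDeriv C G = 0) :
    gaudinOp a L F * gaudinOp a L G = gaudinOp a L (F * G) := by
  induction L generalizing F G with
  | nil => rfl
  | cons i L ih =>
    obtain ⟨hi, hL'⟩ := List.nodup_cons.mp hL
    have hFL := fun j hj => hF j (List.mem_cons_of_mem i hj)
    have h1 := ih hL' hFL fun C hC => h C (hC.cons i)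
    have h2 : gaudinOp a L (polyDeriv i F) * gaudinOp a L (polyDeriv i G) = 0 := by
      rw [ih hL' fun j hj => (hFL j hj).polyDeriv (ne_of_mem_of_not_mem hj hi)]
      · have h0 := h [i] (List.singleton_sublist.mpr List.mem_cons_self) (by simp)
        rw [iterDeriv_cons, iterDeriv_cons, iterDeriv_nil, iterDeriv_nil] at h0
        rw [h0, map_zero]
      · intro C hC _
        have hiC : i ∉ C := fun h => hi (hC.subset h)
        rw [← polyDeriv_iterDeriv hiC, ← polyDeriv_iterDeriv hiC]
        exact h (i :: C) (hC.cons_cons i) (by simp)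
    rw [gaudinOp_cons_mul hi (hF i List.mem_cons_self), h1, h2, smul_zero, add_zero,
      gaudinOp_cons]

theorem trivialAt_smul_one (i : Fin n) (r : TwistRing N) :
    TrivialAt i (r • (1 : PolyOp N n)) := (TrivialAt.one i).smul_ring r

section OneMoreSite

variable {i : Fin n} {L : List (Fin n)}

theorem trivialAt_polyDeriv_smul_one (hi : i ∉ L) (r : TwistRing N) :
    ∀ j ∈ L, TrivialAt j (polyDeriv i (r • (1 : PolyOp N n))) := fun j hj =>
  (trivialAt_smul_one j r).polyDeriv (ne_of_mem_of_not_mem hj hi)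

theorem gaudinOp_polyDeriv_commute {ε : ℂ} (hε : ε * ε = 1) {c : ℕ → TwistRing N}
    (hc : IsTwisted ε c) (hL : (i :: L).Nodup) (m m' : ℕ) :
    Commute (gaudinOp a L (polyDeriv i (c m • (1 : PolyOp N n))))
      (gaudinOp a L (polyDeriv i (c m' • 1))) := by
  obtain ⟨hi, hL'⟩ := List.nodup_cons.mp hL
  refine gaudinOp_commute hL' (trivialAt_polyDeriv_smul_one hi _)
    (trivialAt_polyDeriv_smul_one hi _) fun C hC => ?_
  have hiC : i ∉ C := fun h => hi (hC.subset h)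
  rw [← polyDeriv_iterDeriv hiC, ← polyDeriv_iterDeriv hiC]
  exact iterDeriv_commute hε hc (C := i :: C) (List.nodup_cons.mpr ⟨hiC, hC.nodup hL'⟩) m m'

theorem polyDeriv_hookPoly (l k : ℕ) :
    polyDeriv i (hookPoly N l k • (1 : PolyOp N n)) =
        polyDeriv i (completePoly N (l + 1) • 1) * polyDeriv i (elemPoly N (k + 1) • 1) ∧
      polyDeriv i (hookPoly N l k • (1 : PolyOp N n)) =
        polyDeriv i (elemPoly N (k + 1) • 1) * polyDeriv i (completePoly N (l + 1) • 1) := by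
  have h : polyDeriv i (hookPoly N l k • (1 : PolyOp N n)) =
      site i (grad (completePoly N (l + 1)) * grad (elemPoly N (k + 1))) := by
    rw [polyDeriv_smul_one, grad_hookPoly]
  simp only [h, polyDeriv_smul_one, ← site_mul, true_and]
  rw [(commute_grad_hook (l + 1) (k + 1)).eq]

/-- The site `i` is already differentiated in both factors, so any nonempty `C` gives a second
common site, and the mixed products vanish by symmetry against antisymmetry. Thus `gaudinOp` is
multiplicative here and carries over the rank-one identity for gradients. Both orders are recorded
because together they show that the factors commute. -/
theorem gaudinOp_polyDeriv_hookPoly (hL : (i :: L).Nodup) (l k : ℕ) :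
    gaudinOp a L (polyDeriv i (hookPoly N l k • (1 : PolyOp N n))) =
        gaudinOp a L (polyDeriv i (completePoly N (l + 1) • 1)) *
          gaudinOp a L (polyDeriv i (elemPoly N (k + 1) • 1)) ∧
      gaudinOp a L (polyDeriv i (hookPoly N l k • (1 : PolyOp N n))) =
        gaudinOp a L (polyDeriv i (elemPoly N (k + 1) • 1)) *
          gaudinOp a L (polyDeriv i (completePoly N (l + 1) • 1)) := by
  obtain ⟨hi, hL'⟩ := List.nodup_cons.mp hL
  have key : ∀ C : List (Fin n), C.Sublist L → C ≠ [] → ∀ m m',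
      iterDeriv C (polyDeriv i (completePoly N m • (1 : PolyOp N n))) *
          iterDeriv C (polyDeriv i (elemPoly N m' • 1)) = 0 ∧
        iterDeriv C (polyDeriv i (elemPoly N m' • (1 : PolyOp N n))) *
          iterDeriv C (polyDeriv i (completePoly N m • 1)) = 0 := by
    intro C hC hne m m'
    have hiC : i ∉ C := fun h => hi (hC.subset h)
    obtain ⟨j, hj⟩ := List.exists_mem_of_ne_nil C hne
    rw [← polyDeriv_iterDeriv hiC, ← polyDeriv_iterDeriv hiC]
    exact iterDeriv_mul_iterDeriv_eq_zero isTwisted_completePoly isTwisted_elemPoly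
      (C := i :: C) (List.nodup_cons.mpr ⟨hiC, hC.nodup hL'⟩) List.mem_cons_self
      (List.mem_cons_of_mem i hj) (fun e => hiC (e ▸ hj)) m m'
  constructor
  · rw [gaudinOp_mul hL' (trivialAt_polyDeriv_smul_one hi _) fun C hC hne =>
      (key C hC hne _ _).1, (polyDeriv_hookPoly l k).1]
  · rw [gaudinOp_mul hL' (trivialAt_polyDeriv_smul_one hi _) fun C hC hne =>
      (key C hC hne _ _).2, (polyDeriv_hookPoly l k).2]

theorem gaudinOp_polyDeriv_hookPoly_commute (hL : (i :: L).Nodup) (l k l' k' : ℕ) :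
    Commute (gaudinOp a L (polyDeriv i (hookPoly N l k • (1 : PolyOp N n))))
      (gaudinOp a L (polyDeriv i (hookPoly N l' k' • 1))) := by
  have hα := gaudinOp_polyDeriv_commute (a := a) (n := n) (by ring)
    (isTwisted_completePoly (N := N)) hL
  have hβ := gaudinOp_polyDeriv_commute (a := a) (n := n) (by ring)
    (isTwisted_elemPoly (N := N)) hL
  have hαβ : ∀ l k, Commute (gaudinOp a L (polyDeriv i (completePoly N (l + 1) • (1 : PolyOp N n))))
      (gaudinOp a L (polyDeriv i (elemPoly N (k + 1) • 1))) := fun l k =>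
    (gaudinOp_polyDeriv_hookPoly hL l k).1.symm.trans (gaudinOp_polyDeriv_hookPoly hL l k).2
  rw [(gaudinOp_polyDeriv_hookPoly hL l k).1, (gaudinOp_polyDeriv_hookPoly hL l' k').1]
  exact ((hα _ _).mul_right (hαβ _ _)).mul_left ((hαβ _ _).symm.mul_right (hβ _ _))

end OneMoreSite

/-- The Gaudin transfer matrices of hook shape commute. -/
theorem gaudinOp_hookPoly_commute {L : List (Fin n)} (hL : L.Nodup) (l k l' k' : ℕ) :
    Commute (gaudinOp a L (hookPoly N l k • (1 : PolyOp N n)))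
      (gaudinOp a L (hookPoly N l' k' • 1)) := by
  induction L with
  | nil =>
    exact ((Commute.one_left _).smul_left _)
  | cons i L ih =>
    obtain ⟨hi, hL'⟩ := List.nodup_cons.mp hL
    rw [Commute, SemiconjBy, gaudinOp_cons_mul hi (trivialAt_smul_one i _),
      gaudinOp_cons_mul hi (trivialAt_smul_one i _), (ih hL').eq,
      (gaudinOp_polyDeriv_hookPoly_commute hL l k l' k').eq]

theorem completePoly_zero : completePoly N 0 = 1 := newtonSeq_zero _

theorem polyDeriv_hookPoly_zero (i : Fin n) :
    polyDeriv i (hookPoly N 0 0 • (1 : PolyOp N n)) = 1 := by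
  rw [polyDeriv_smul_one, hookPoly_zero_right, isTwisted_completePoly.grad_succ,
    isTwisted_completePoly.grad_zero, completePoly_zero, mul_zero, smul_zero, add_zero, one_smul,
    site_one]

open Polynomial in
/-- The Giambelli formula for the Gaudin transfer matrices with polynomial twist. -/
theorem gaudinOp_det_hookPoly {L : List (Fin n)} (hL : L.Nodup) {d : ℕ} (r s : Fin d → ℕ) :
    opDet (Matrix.of fun i j => gaudinOp a L (hookPoly N (r i) (s j) • (1 : PolyOp N n))) =
      gaudinOp a L ((Matrix.of fun i j => hookPoly N (r i) (s j)).det • 1) := by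
  induction L with
  | nil =>
    have h := opDet_map (algebraMap (TwistRing N) (PolyOp N n))
      (Matrix.of fun i j => hookPoly N (r i) (s j))
    rw [opDet_eq_det] at h
    rw [gaudinOp_nil, ← Algebra.algebraMap_eq_smul_one, h]
    congr 1
    ext1 i j
    simp only [gaudinOp_nil, Matrix.of_apply, Matrix.map_apply, Algebra.algebraMap_eq_smul_one]
  | cons i L ih =>
    obtain ⟨hi, hL'⟩ := List.nodup_cons.mp hL
    rcases subsingleton_or_nontrivial (PolyOp N n) with hsub | hnt
    · exact Subsingleton.elim _ _
    let Φ : ℕ → ℕ → PolyOp N n := fun l k => gaudinOp a L (hookPoly N l k • 1)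
    let E : ℕ → ℕ → PolyOp N n := fun l k => polyDeriv i (Φ l k)
    have hE : ∀ l k, E l k = gaudinOp a L (polyDeriv i (hookPoly N l k • 1)) := fun l k =>
      polyDeriv_gaudinOp hi _
    have hEE : ∀ l k l' k', E l k * E l' k' = E l' k' * E l k := fun l k l' k' => by
      simp only [hE]
      exact (gaudinOp_polyDeriv_hookPoly_commute hL l k l' k').eq
    have hΦΦ : ∀ l k l' k', Φ l k * Φ l' k' = Φ l' k' * Φ l k := fun l k l' k' =>
      (gaudinOp_hookPoly_commute hL' l k l' k').eq
    have hΦ : ∀ l k, TrivialAt i (Φ l k) := fun l k => (trivialAt_smul_one i _).gaudinOp hi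
    -- The derivative at `i` of `Φ Φ' = Φ' Φ`. It settles the linear coefficient in the commutation
    -- of the pencils `Φ + X E`, whose single entries `Φ` and `E` are not claimed to commute.
    have hΦE : ∀ l k l' k', E l k * Φ l' k' + Φ l k * E l' k' =
        E l' k' * Φ l k + Φ l' k' * E l k := fun l k l' k' => by
      rw [← polyDeriv_mul i (hΦ l k), ← polyDeriv_mul i (hΦ l' k'), hΦΦ]
    have hX : ∀ x y : PolyOp N n, X * C x * C y = X * C (x * y) := fun x y => by
      rw [mul_assoc, ← C_mul]
    have hX' : ∀ x y : PolyOp N n, C x * (X * C y) = X * C (x * y) := fun x y => by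
      rw [← mul_assoc, ← X_mul_C, mul_assoc, ← C_mul]
    have hX'' : ∀ x y : PolyOp N n, X * C x * (X * C y) = X * (X * C (x * y)) := fun x y => by
      rw [mul_assoc, hX']
    have hcomm : ∀ l k l' k', Commute (C (Φ l k) + X * C (E l k))
        (C (Φ l' k') + X * C (E l' k')) := by
      have hexp : ∀ l k l' k', (C (Φ l k) + X * C (E l k)) * (C (Φ l' k') + X * C (E l' k')) =
          C (Φ l k * Φ l' k') + X * C (E l k * Φ l' k' + Φ l k * E l' k') +
            X * (X * C (E l k * E l' k')) := fun l k l' k' => by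
        rw [add_mul, mul_add, mul_add, hX, hX', hX'', ← C_mul, C_add, mul_add]
        abel
      intro l k l' k'
      rw [Commute, SemiconjBy, hexp, hexp, hΦΦ, hΦE, hEE]
    -- The distinguished index is `0`: the hooks `(l|0)` and `(0|k)` are `h_{l+1}` and `e_{k+1}`,
    -- and `E_{00} = 1` because the gradient of `tr H` is the identity.
    have hdeg := natDegree_opDet_le_one Φ E 0 hcomm (fun l k => ?_) ?_ r s
    · have h := opDet_add_smul (δ := (polyDeriv i : PolyOp N n →ₗ[ℂ] PolyOp N n).toAddMonoidHom)
        (P := TrivialAt i) (fun x y hx => polyDeriv_mul i hx y) (polyDeriv_one i)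
        (Matrix.of fun i j => Φ (r i) (s j)) (fun _ _ => hΦ _ _) hdeg (a i)
      rw [gaudinOp_cons, ← ih hL']
      exact h
    · rw [hE, hE, hE, hookPoly_zero_right, hookPoly_zero_left]
      exact (gaudinOp_polyDeriv_hookPoly hL l k).1
    · rw [hE, polyDeriv_hookPoly_zero, gaudinOp_one]

end GaudinInduction

/-! ### Evaluation at a twist matrix and comparison with analytic derivatives -/

section Evaluation

variable {N n : ℕ}

/-- Evaluation of polynomials at a twist matrix. -/
def evalAt (h : Matrix (Fin N) (Fin N) ℂ) : TwistRing N →ₐ[ℂ] ℂ :=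
  MvPolynomial.aeval fun ab : Fin N × Fin N => h ab.1 ab.2

/-- Evaluation of operator-valued polynomials at a twist matrix. -/
def evalOp (h : Matrix (Fin N) (Fin N) ℂ) : PolyOp N n →ₐ[ℂ] Op N n := (evalAt h).mapMatrix

variable (h : Matrix (Fin N) (Fin N) ℂ)

theorem evalOp_apply (F : PolyOp N n) (u v : Fin n → Fin N) :
    evalOp h F u v = evalAt h (F u v) := rfl

theorem evalAt_completePoly (m : ℕ) : evalAt h (completePoly N m) = completeSeq h m := by
  have hg : (evalAt h).mapMatrix (generic N) = h := by
    ext1 a b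
    simp [generic, evalAt]
  rw [completePoly, map_newtonSeq, completeSeq]
  congr 1
  funext k
  have h1 : evalAt h (generic N ^ k).trace = ((evalAt h).mapMatrix (generic N ^ k)).trace :=
    AddMonoidHom.map_trace (evalAt h).toRingHom.toAddMonoidHom _
  rw [h1, map_pow, hg]

theorem evalAt_hookPoly (l k : ℕ) : evalAt h (hookPoly N l k) = hookSeq (completeSeq h) l k := by
  have h1 := map_hookSeq (evalAt h : TwistRing N →+* ℂ) (completePoly N) l k
  simp only [RingHom.coe_coe, evalAt_completePoly] at h1
  exact h1

theorem evalOp_smul_one (r : TwistRing N) :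
    evalOp h (r • (1 : PolyOp N n)) = evalAt h r • (1 : Op N n) := by
  ext1 u v
  rw [evalOp_apply, Matrix.smul_apply, smul_eq_mul, map_mul, Matrix.smul_apply, smul_eq_mul,
    Matrix.one_apply, Matrix.one_apply]
  split_ifs <;> simp

/-- The Schur characters of the generic twist matrix. -/
def chiPoly (N : ℕ) (μ : YoungDiagram) : TwistRing N :=
  (Matrix.of fun i j : Fin (diagLen μ) =>
    hookPoly N (μ.rowLen i - (i + 1)) (μ.colLen j - (j + 1))).det

theorem evalAt_chiPoly (μ : YoungDiagram) : evalAt h (chiPoly N μ) = chi μ h := by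
  rw [chiPoly, chi_eq_det, AlgHom.map_det]
  congr 1
  ext1 i j
  exact evalAt_hookPoly h _ _

theorem hasDerivAt_evalAt (b a : Fin N) (P : TwistRing N) :
    HasDerivAt (fun ε : ℂ => evalAt (h + ε • Matrix.single b a 1) P)
      (evalAt h (MvPolynomial.pderiv (b, a) P)) 0 := by
  induction P using MvPolynomial.induction_on with
  | C c =>
    simpa [evalAt] using hasDerivAt_const (0 : ℂ) c
  | add P Q hP hQ => simp only [map_add]; exact hP.add hQ
  | mul_X P cd hP =>
    have hX : HasDerivAt (fun ε : ℂ => evalAt (h + ε • Matrix.single b a 1)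
        (MvPolynomial.X cd : TwistRing N))
        (evalAt h (MvPolynomial.pderiv (b, a) (MvPolynomial.X cd))) 0 := by
      have h1 := ((hasDerivAt_id (0 : ℂ)).mul_const
        ((Matrix.single b a (1 : ℂ)) cd.1 cd.2)).const_add (h cd.1 cd.2)
      have h2 : evalAt h (MvPolynomial.pderiv (b, a) (MvPolynomial.X cd)) =
          1 * (Matrix.single b a (1 : ℂ)) cd.1 cd.2 := by
        obtain ⟨c, d⟩ := cd
        rw [MvPolynomial.pderiv_X, Matrix.single_apply, Pi.single_apply, one_mul]
        have : (c, d) = (b, a) ↔ b = c ∧ a = d := by rw [Prod.mk.injEq, eq_comm, eq_comm (a := d)]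
        simp only [this]
        split_ifs <;> simp
      rw [h2]
      refine h1.congr_of_eventuallyEq (Filter.Eventually.of_forall fun ε => ?_)
      simp [evalAt, -Matrix.smul_single]
    have h1 := hP.mul hX
    rw [zero_smul, add_zero] at h1
    rw [Derivation.leibniz, smul_eq_mul, smul_eq_mul, map_add, map_mul, map_mul]
    simp only [map_mul]
    refine HasDerivAt.congr_deriv h1 ?_
    ring

theorem dirDeriv_evalOp (b a : Fin N) (F : PolyOp N n) :
    dirDeriv (fun h => evalOp h F) (Matrix.single b a 1) h = evalOp h (entryDeriv b a F) := by
  ext1 u v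
  exact (hasDerivAt_evalAt h b a (F u v)).deriv

theorem evalOp_polyUnit (i : Fin n) (a b : Fin N) :
    evalOp h (polyUnit i a b) = siteUnit i a b := by
  ext1 u v
  rw [evalOp_apply, polyUnit, site_apply, Matrix.single_apply, siteUnit, Matrix.of_apply]
  simp only [eq_comm (a := a), eq_comm (a := b)]
  split_ifs <;> simp_all

theorem matDeriv_evalOp (i : Fin n) (F : PolyOp N n) :
    matDeriv i (fun h => evalOp h F) = fun h => evalOp h (polyDeriv i F) := by
  funext h
  simp only [matDeriv, dirDeriv_evalOp, polyDeriv_apply, map_sum, map_mul, evalOp_polyUnit]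

end Evaluation

/-! ### Transfer matrices and passage to the polynomial normalization -/

section TransferMatrices

variable {N n : ℕ}

/-- The operator `∏_{i ∈ L} (b_i + ∂_i)`, the head of the list being applied last. -/
def gaudinPolyOp (b : Fin n → ℂ) : List (Fin n) → PolyOp N n →ₗ[ℂ] PolyOp N n
  | [] => LinearMap.id
  | i :: L => b i • gaudinPolyOp b L + polyDeriv i ∘ₗ gaudinPolyOp b L

theorem gaudinPolyOp_cons (b : Fin n → ℂ) (i : Fin n) (L : List (Fin n)) (F : PolyOp N n) :
    gaudinPolyOp b (i :: L) F = b i • gaudinPolyOp b L F + polyDeriv i (gaudinPolyOp b L F) := rfl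

theorem gaudinPolyOp_eq_smul {b : Fin n → ℂ} (hb : ∀ i, b i ≠ 0) (L : List (Fin n))
    (F : PolyOp N n) :
    gaudinPolyOp b L F = (L.map b).prod • gaudinOp (fun i => (b i)⁻¹) L F := by
  induction L with
  | nil => exact (one_smul ℂ F).symm
  | cons i L ih =>
    rw [gaudinPolyOp_cons, ih, gaudinOp_cons, List.map_cons, List.prod_cons, map_smul, smul_add,
      smul_smul, smul_smul, mul_right_comm, mul_inv_cancel₀ (hb i), one_mul]

theorem continuous_evalOp_gaudinPolyOp {b : ℂ → Fin n → ℂ} (hb : ∀ i, Continuous fun x => b x i)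
    (h : Matrix (Fin N) (Fin N) ℂ) (L : List (Fin n)) (F : PolyOp N n) :
    Continuous fun x => evalOp h (gaudinPolyOp (b x) L F) := by
  -- The auxiliary linear map `D` absorbs the derivatives during the induction, so continuity is
  -- only ever asserted for evaluated operators.
  suffices H : ∀ D : PolyOp N n →ₗ[ℂ] PolyOp N n,
      Continuous fun x => evalOp h (D (gaudinPolyOp (b x) L F)) from H LinearMap.id
  induction L with
  | nil => exact fun D => continuous_const (y := evalOp h (D F))
  | cons i L ih =>
    intro D
    simp only [gaudinPolyOp_cons, map_add, map_smul]
    exact ((hb i).smul (ih D)).add (ih (D ∘ₗ polyDeriv i))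

/-- The list `L'` records the factors already applied. The fold applies the first site first while
`gaudinOp` applies the head last, hence the reversal. -/
theorem foldl_gaudinOp (a : Fin n → ℂ) (L L' : List (Fin n)) (F : PolyOp N n) :
    L.foldl (fun F i => fun h => F h + a i • matDeriv i F h)
      (fun h : Matrix (Fin N) (Fin N) ℂ => evalOp h (gaudinOp a L' F)) =
      fun h => evalOp h (gaudinOp a (L.reverse ++ L') F) := by
  induction L generalizing L' with
  | nil => rfl
  | cons i L ih =>
    rw [List.foldl_cons, matDeriv_evalOp]
    have h1 := ih (i :: L')
    simp only [gaudinOp_cons, map_add, map_smul] at h1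
    rw [h1, List.reverse_cons, List.append_assoc, List.singleton_append]

theorem foldl_gaudinPolyOp (b : Fin n → ℂ) (L L' : List (Fin n)) (F : PolyOp N n) :
    L.foldl (fun F i => fun h => b i • F h + matDeriv i F h)
      (fun h : Matrix (Fin N) (Fin N) ℂ => evalOp h (gaudinPolyOp b L' F)) =
      fun h => evalOp h (gaudinPolyOp b (L.reverse ++ L') F) := by
  induction L generalizing L' with
  | nil => rfl
  | cons i L ih =>
    rw [List.foldl_cons, matDeriv_evalOp]
    have h1 := ih (i :: L')
    simp only [gaudinPolyOp_cons, map_add, map_smul] at h1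
    rw [h1, List.reverse_cons, List.append_assoc, List.singleton_append]

variable (p : Fin n → ℂ) (h : Matrix (Fin N) (Fin N) ℂ)

theorem transferN_eq (x : ℂ) {μ : YoungDiagram} {P : TwistRing N}
    (hP : ∀ h, evalAt h P = chi μ h) :
    transferN p x μ h =
      evalOp h (gaudinOp (fun i => (x - p i)⁻¹) (List.finRange n).reverse (P • 1)) := by
  have h1 := congrFun (foldl_gaudinOp (fun i => (x - p i)⁻¹) (List.finRange n) []
    (P • (1 : PolyOp N n))) h
  simp only [gaudinOp_nil, evalOp_smul_one, hP, List.append_nil] at h1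
  exact h1

theorem transferPoly_eq (x : ℂ) {μ : YoungDiagram} {P : TwistRing N}
    (hP : ∀ h, evalAt h P = chi μ h) :
    transferPoly p x μ h =
      evalOp h (gaudinPolyOp (fun i => x - p i) (List.finRange n).reverse (P • 1)) := by
  have h1 := congrFun (foldl_gaudinPolyOp (fun i => x - p i) (List.finRange n) []
    (P • (1 : PolyOp N n))) h
  simp only [gaudinPolyOp, LinearMap.id_apply, evalOp_smul_one, hP, List.append_nil] at h1
  exact h1

theorem evalAt_hookPoly_eq_chi (l k : ℕ) (h : Matrix (Fin N) (Fin N) ℂ) :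
    evalAt h (hookPoly N l k) = chi (hook l k) h := by
  rw [evalAt_hookPoly, chi_hook]

theorem nodup_reverse_finRange (n : ℕ) : (List.finRange n).reverse.Nodup :=
  List.nodup_reverse.mpr (List.nodup_finRange n)

theorem transferN_hook_commute (x : ℂ) (l k l' k' : ℕ) :
    Commute (transferN p x (hook l k) h) (transferN p x (hook l' k') h) := by
  rw [transferN_eq p h x (evalAt_hookPoly_eq_chi l k),
    transferN_eq p h x (evalAt_hookPoly_eq_chi l' k')]
  exact (gaudinOp_hookPoly_commute (nodup_reverse_finRange n) l k l' k').map (evalOp h)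

theorem transferN_giambelli (x : ℂ) (μ : YoungDiagram) :
    transferN p x μ h =
      opDet (Matrix.of fun i j => transferN p x (frobeniusHook μ i j) h) := by
  have h1 := opDet_map (evalOp h : PolyOp N n →ₐ[ℂ] Op N n).toRingHom
    (Matrix.of fun i j : Fin (diagLen μ) =>
      gaudinOp (fun i => (x - p i)⁻¹) (List.finRange n).reverse
        (hookPoly N (μ.rowLen i - (i + 1)) (μ.colLen j - (j + 1)) • (1 : PolyOp N n)))
  rw [gaudinOp_det_hookPoly (nodup_reverse_finRange n)
    (fun i : Fin (diagLen μ) => μ.rowLen i - (i + 1))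
    (fun j : Fin (diagLen μ) => μ.colLen j - (j + 1))] at h1
  rw [transferN_eq p h x (fun h => evalAt_chiPoly h μ)]
  refine h1.trans (congrArg opDet ?_)
  ext1 i j
  exact (transferN_eq p h x (evalAt_hookPoly_eq_chi _ _)).symm

theorem transferN_bot (x : ℂ) : transferN p x ⊥ h = 1 := by
  rw [transferN_eq p h x (P := 1) fun h => by rw [map_one, chi_bot], one_smul, gaudinOp_one,
    map_one]

theorem transferPoly_eq_smul_transferN {x : ℂ} (hx : ∀ i, x ≠ p i) (μ : YoungDiagram) :
    transferPoly p x μ h =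
      ((List.finRange n).reverse.map fun i => x - p i).prod • transferN p x μ h := by
  rw [transferN_eq p h x (fun h => evalAt_chiPoly h μ),
    transferPoly_eq p h x (fun h => evalAt_chiPoly h μ),
    gaudinPolyOp_eq_smul (fun i => sub_ne_zero.mpr (hx i)), map_smul]

theorem continuous_transferPoly (μ : YoungDiagram) :
    Continuous fun x => transferPoly p x μ h := by
  have h1 := fun x => transferPoly_eq p h x (fun h => evalAt_chiPoly h μ)
  simp only [h1]
  exact continuous_evalOp_gaudinPolyOp (fun i => continuous_id.sub continuous_const) h _ _

theorem continuous_opDet {X R : Type*} [TopologicalSpace X] [Ring R] [TopologicalSpace R]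
    [IsTopologicalRing R] {d : ℕ} {A : X → Matrix (Fin d) (Fin d) R}
    (hA : ∀ i j, Continuous fun x => A x i j) : Continuous fun x => opDet (A x) := by
  simp only [opDet, List.ofFn_eq_map]
  refine continuous_finsetSum _ fun σ _ => Continuous.zsmul ?_ _
  exact continuous_list_prod _ fun j _ => hA _ _

theorem opDet_smul {R S : Type*} [CommRing S] [Ring R] [Algebra S R] {d : ℕ} (c : S)
    (A : Matrix (Fin d) (Fin d) R) : opDet (c • A) = c ^ d • opDet A := by
  have key : ∀ l : List R, (l.map (c • ·)).prod = c ^ l.length • l.prod := fun l => by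
    induction l with
    | nil => simp
    | cons x l ih =>
      rw [List.map_cons, List.prod_cons, ih, List.prod_cons, smul_mul_smul_comm, List.length_cons,
        pow_succ']
  rw [opDet, opDet, Finset.smul_sum]
  refine Finset.sum_congr rfl fun σ _ => ?_
  have h1 := key (List.ofFn fun j => A (σ j) j)
  rw [List.map_ofFn, List.length_ofFn] at h1
  rw [smul_comm, ← h1]
  rfl

theorem dense_setOf_forall_ne : Dense {x : ℂ | ∀ i, x ≠ p i} := by
  have h1 : {x : ℂ | ∀ i, x ≠ p i} = (Set.range p)ᶜ := by
    ext x
    simp [eq_comm]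
  rw [h1]
  exact (Set.finite_range p).countable.dense_compl ℂ

theorem transferPoly_hook_commute (x : ℂ) (l k l' k' : ℕ) :
    Commute (transferPoly p x (hook l k) h) (transferPoly p x (hook l' k') h) := by
  have hc := continuous_transferPoly p h (hook l k)
  have hc' := continuous_transferPoly p h (hook l' k')
  refine congrFun (Continuous.ext_on (dense_setOf_forall_ne p) (hc.mul hc') (hc'.mul hc)
    fun x hx => ?_) x
  simp only [Pi.mul_apply, transferPoly_eq_smul_transferN p h hx]
  exact (((transferN_hook_commute p h x l k l' k').smul_left _).smul_right _).eq

/-- Away from the marked points both sides are the normalized ones times the `d(μ)`-th power of `∏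
(x - x_i)`. On the left one power comes from `μ` and `d(μ) - 1` from the empty diagram, which needs
`d(μ) > 0`. Both sides are continuous in `x` and the marked points have dense complement. -/
theorem transferPoly_giambelli (x : ℂ) {μ : YoungDiagram} (hμ : μ ≠ ⊥) :
    transferPoly p x μ h * transferPoly p x ⊥ h ^ (diagLen μ - 1) =
      opDet (Matrix.of fun i j => transferPoly p x (frobeniusHook μ i j) h) := by
  refine congrFun (Continuous.ext_on (dense_setOf_forall_ne p)
    (f := fun x => transferPoly p x μ h * transferPoly p x ⊥ h ^ (diagLen μ - 1))
    (g := fun x => opDet (Matrix.of fun i j => transferPoly p x (frobeniusHook μ i j) h))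
    ((continuous_transferPoly p h μ).mul ((continuous_transferPoly p h ⊥).pow _))
    (continuous_opDet fun i j => continuous_transferPoly p h (frobeniusHook μ i j))
    fun x hx => ?_) x
  simp only [transferPoly_eq_smul_transferN p h hx]
  rw [transferN_bot, smul_pow, one_pow, smul_mul_smul_comm, mul_one, ← pow_succ',
    Nat.sub_add_cancel (diagLen_pos hμ), transferN_giambelli p h x μ, ← opDet_smul]
  rfl

end TransferMatrices

end Gaudin

end

theorem mainTheorem3 (N n : ℕ) (h : Matrix (Fin N) (Fin N) ℂ) (p : Fin n → ℂ) (x : ℂ) :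
    ((∀ i, x ≠ p i) →
      (∀ l k l' k' : ℕ, Commute (Gaudin.transferN p x (Gaudin.hook l k) h)
        (Gaudin.transferN p x (Gaudin.hook l' k') h)) ∧
      ∀ μ : YoungDiagram,
        Gaudin.transferN p x μ h =
          Gaudin.opDet (Matrix.of fun i j =>
            Gaudin.transferN p x (Gaudin.frobeniusHook μ i j) h)) ∧
    (∀ l k l' k' : ℕ, Commute (Gaudin.transferPoly p x (Gaudin.hook l k) h)
      (Gaudin.transferPoly p x (Gaudin.hook l' k') h)) ∧
    ∀ μ : YoungDiagram, μ ≠ ⊥ →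
      Gaudin.transferPoly p x μ h *
          Gaudin.transferPoly p x ⊥ h ^ (Gaudin.diagLen μ - 1) =
        Gaudin.opDet (Matrix.of fun i j =>
          Gaudin.transferPoly p x (Gaudin.frobeniusHook μ i j) h) := by
  exact ⟨fun _ => ⟨Gaudin.transferN_hook_commute p h x, Gaudin.transferN_giambelli p h x⟩,
    Gaudin.transferPoly_hook_commute p h x, fun _ hμ => Gaudin.transferPoly_giambelli p h x hμ⟩
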